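/- Let $q\ge 2$ be an integer. On four qudits of local dimension $q$, labelled $1,2,3,4$, let $(\cdot)^{\otimes 2,2}:=(\cdot)^{\otimes 2}\otimes\overline{(\cdot)}^{\,\otimes 2}$, where the bar denotes entrywise complex conjugation, and consider the operators on $\big((\mathbb C^q)^{\otimes 4}\big)^{\otimes 4}$ $$h_{i,j}=\mathbb I-(P_H)_{i,j}\otimes\mathbb I_{[4]\setminus\{i,j\}},\qquad (P_H)_{i,j}=\int_{\mathcal U(q^2)}U_{i,j}^{\otimes 2,2}\,d\mu_{\mathrm{Haar}}(U),$$ where $\mu_{\mathrm{Haar}}$ is the normalized Haar measure on the group $\mathcal U(q^2)$ of unitaries acting on two qudits, $U_{i,j}$ is $U$ acting on the sites $i$ and $j$, and $\mathbb I_{[4]\setminus\{i,j\}}$ is the identity on (all copies of) the other sites. Let $$H_q=h_{1,4}+h_{2,4}+h_{3,4}$$ be the second-moment ($k=2$) random-quantum-circuit Hamiltonian of the star graph with centre $4$ and leaves $1,2,3$, i.e. the sum of $h_{i,j}$ over the edges of that graph. Then $H_q$ is Hermitian, and its spectral gap $\Delta(H_q)$, i.e. the difference of its two smallest distinct eigenvalues,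 is $$\Delta(H_q)=\frac32-\frac{\sqrt{q^4+18q^2+1}}{2(q^2+1)}.$$ In particular $\Delta(H_2)=\frac32-\frac{\sqrt{89}}{10}\approx 0.556602$ (correct to six decimals), and $\Delta(H_q)\to1$ as $q\to\infty$. -/

import Mathlib

open scoped Kronecker

namespace RQC

noncomputable section

instance unitaryMeasurableSpace (ι : Type) [Fintype ι] [DecidableEq ι] :
    MeasurableSpace (Matrix.unitaryGroup ι ℂ) := borel _

instance unitaryBorelSpace (ι : Type) [Fintype ι] [DecidableEq ι] :
    BorelSpace (Matrix.unitaryGroup ι ℂ) := ⟨rfl⟩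

instance unitaryCompactSpace (ι : Type) [Fintype ι] [DecidableEq ι] :
    CompactSpace (Matrix.unitaryGroup ι ℂ) := by
  refine (isCompact_iff_compactSpace (s := (Matrix.unitaryGroup ι ℂ : Set (Matrix ι ι ℂ)))).mp ?_
  have hK : IsCompact (Set.pi Set.univ fun _ : ι => Set.pi Set.univ fun _ : ι =>
      Metric.closedBall (0 : ℂ) 1) :=
    isCompact_univ_pi fun _ => isCompact_univ_pi fun _ => isCompact_closedBall _ _
  have hC : IsClosed {U : Matrix ι ι ℂ | star U * U = 1 ∧ U * star U = 1} :=
    (isClosed_eq (continuous_star.mul continuous_id) continuous_const).inter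
      (isClosed_eq (continuous_id.mul continuous_star) continuous_const)
  refine IsCompact.of_isClosed_subset (s := Set.pi Set.univ fun _ : ι =>
    Set.pi Set.univ fun _ : ι => Metric.closedBall (0 : ℂ) 1) hK hC ?_
  intro U hU i _ j _
  simpa using entry_norm_bound_of_unitary (𝕜 := ℂ) (U := U) hU i j

/-- The normalized Haar measure on the group of unitary matrices indexed by `ι`. -/
def unitaryHaar (ι : Type) [Fintype ι] [DecidableEq ι] :
    MeasureTheory.Measure (Matrix.unitaryGroup ι ℂ) :=
  MeasureTheory.Measure.haarMeasure ⊤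

/-- The tensor power `A^{⊗ k}`, acting on `k` copies of the space with basis `X`. -/
def tensorPow {X : Type} (k : ℕ) (A : Matrix X X ℂ) : Matrix (Fin k → X) (Fin k → X) ℂ :=
  Matrix.of fun x y => ∏ a, A (x a) (y a)

/-- `A^{⊗ k,k} = A^{⊗ k} ⊗ (conj A)^{⊗ k}`, with the entrywise complex conjugate. -/
def tensorPowConj {X : Type} (k : ℕ) (A : Matrix X X ℂ) :
    Matrix ((Fin k → X) × (Fin k → X)) ((Fin k → X) × (Fin k → X)) ℂ :=
  tensorPow k A ⊗ₖ tensorPow k (A.map (starRingEnd ℂ))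

/-- The two-site operator `U` on the sites `i ≠ j`, tensored with the identity on all other sites.
The basis of `n` qudits of local dimension `q` is `Fin n → Fin q`. -/
def twoSite {n q : ℕ} (i j : Fin n) (U : Matrix (Fin q × Fin q) (Fin q × Fin q) ℂ) :
    Matrix (Fin n → Fin q) (Fin n → Fin q) ℂ :=
  Matrix.of fun x y =>
    if ∀ v, v ≠ i → v ≠ j → x v = y v then U (x i, x j) (y i, y j) else 0

/-- Basis of `k` copies of the `n`-qudit space and `k` copies of its conjugate. -/
abbrev Idx (n q k : ℕ) : Type := (Fin k → (Fin n → Fin q)) × (Fin k → (Fin n → Fin q))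

/-- The local moment operator `(P_H)_{i,j} ⊗ 𝟙`: the (entrywise) integral of
`(U_{i,j} ⊗ 𝟙)^{⊗ k,k}` over Haar-random `U` in the two-site unitary group `U(q²)`. -/
def localMoment {n : ℕ} (q k : ℕ) (i j : Fin n) : Matrix (Idx n q k) (Idx n q k) ℂ :=
  Matrix.of fun x y => ∫ U, tensorPowConj k
    (twoSite i j (U : Matrix (Fin q × Fin q) (Fin q × Fin q) ℂ)) x y
      ∂(unitaryHaar (Fin q × Fin q))

/-- The local Hamiltonian term `h_{i,j} = 𝟙 - (P_H)_{i,j} ⊗ 𝟙`. -/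
def localTerm {n : ℕ} (q k : ℕ) (i j : Fin n) : Matrix (Idx n q k) (Idx n q k) ℂ :=
  1 - localMoment q k i j

/-- The Hamiltonian `H(G, n, k)`: the sum of the local terms over the edges of `G`, each edge
being listed once, as the pair `(i, j)` with `i < j`. -/
def hamiltonian {n : ℕ} (q k : ℕ) (G : SimpleGraph (Fin n)) [DecidableRel G.Adj] :
    Matrix (Idx n q k) (Idx n q k) ℂ :=
  ∑ e : Fin n × Fin n with e.1 < e.2 ∧ G.Adj e.1 e.2, localTerm q k e.1 e.2

/-- The Hamiltonian on the star with `m + 1` sites, whose centre is the last one. -/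
def starHamiltonian (m q k : ℕ) : Matrix (Idx (m + 1) q k) (Idx (m + 1) q k) ℂ :=
  hamiltonian q k (SimpleGraph.starGraph (Fin.last m))

/-- `Δ` is the spectral gap of the Hermitian matrix `H`: the difference of its two smallest
distinct eigenvalues (which in particular exist). -/
def IsSpectralGap {X : Type} [Fintype X] [DecidableEq X] (H : Matrix X X ℂ) (Δ : ℝ) : Prop :=
  H.IsHermitian ∧ ∃ E₀ : ℝ, IsLeast (spectrum ℝ H) E₀ ∧
    IsLeast (spectrum ℝ H \ {E₀}) (E₀ + Δ)

end

end RQC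

namespace RQC

/-! ### Haar moments and the permutation vectors they fix. -/

noncomputable section

open MeasureTheory

variable {X : Type} [Fintype X] [DecidableEq X]

/-! For two copies, Schur–Weyl duality makes the two-site moment operator `P` the orthogonal
projector onto the span of `σ₀ ⊗ σ₀` and `σ₁ ⊗ σ₁`, where `σ₀`, `σ₁` are the vectorized identity and
swap on one qudit. This is proved by hand as the Weingarten formula `haarMoment_two_apply`.
Consequently `P` fixes `σ_s ⊗ σ_s` and sends `σ_s ⊗ σ_r` with `s ≠ r` to `α (σ₀ ⊗ σ₀ + σ₁ ⊗ σ₁)`,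
with `α = q / (q² + 1)`.

An eigenvalue `μ` of the Hamiltonian corresponds to an eigenvalue `t = 3 - μ` of `T = P₁₄ + P₂₄ +
P₃₄`. On products of the `σ`'s, classify configurations by the number `k` of leaves that differ from
the centre. The case `k = 0` gives `t = 3`, the block `k = 1, 2` gives `(t - 1)(t - 2) = 4α²`, and
`k = 3` only `t = 0`. The larger root of the quadratic gives the claimed gap; `starVec` supplies the
eigenvectors.

For the converse, `v` is not decomposed along an invariant subspace but paired with products of the
`σ`'s. If `t > 2`, `t ≠ 3` and `(t - 1)(t - 2) > 4α²`, the 16 full pairings satisfy a linear system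
with only the zero solution. Then the pairings on two leaves and the centre satisfy the analogous
system of a two-leaf star, whose eigenvalues are at most 2, and vanish; then those on one leaf and
the centre vanish. So every `P` kills `v`, and `t v = 0`. This is `IsStarEigen.eq_zero`. -/

instance unitaryHaar_isMulLeftInvariant : (unitaryHaar X).IsMulLeftInvariant :=
  inferInstanceAs (Measure.haarMeasure ⊤).IsMulLeftInvariant

instance unitaryHaar_isProbabilityMeasure : IsProbabilityMeasure (unitaryHaar X) :=
  ⟨by simpa [unitaryHaar] using Measure.haarMeasure_self (K₀ := (⊤ : TopologicalSpace.PositiveCompacts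
    (Matrix.unitaryGroup X ℂ)))⟩

theorem tensorPow_mul {X : Type} [Fintype X] (k : ℕ) (A B : Matrix X X ℂ) :
    tensorPow k (A * B) = tensorPow k A * tensorPow k B := by
  classical
  ext x y
  simp only [tensorPow, Matrix.mul_apply, Matrix.of_apply, Finset.prod_univ_sum,
    Fintype.piFinset_univ, Finset.prod_mul_distrib]

theorem tensorPowConj_mul {X : Type} [Fintype X] (k : ℕ) (A B : Matrix X X ℂ) :
    tensorPowConj k (A * B) = tensorPowConj k A * tensorPowConj k B := by
  simp only [tensorPowConj, Matrix.map_mul, tensorPow_mul, Matrix.mul_kronecker_mul]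

/-- The `k`-th moment operator of the Haar measure. -/
def haarMoment (X : Type) [Fintype X] [DecidableEq X] (k : ℕ) :
    Matrix ((Fin k → X) × (Fin k → X)) ((Fin k → X) × (Fin k → X)) ℂ :=
  Matrix.of fun x y => ∫ U, tensorPowConj k (U : Matrix X X ℂ) x y ∂(unitaryHaar X)

theorem continuous_tensorPowConj (k : ℕ) (x y : (Fin k → X) × (Fin k → X)) :
    Continuous fun U : Matrix.unitaryGroup X ℂ => tensorPowConj k (U : Matrix X X ℂ) x y := by
  have h (a b : X) : Continuous fun U : Matrix.unitaryGroup X ℂ => (U : Matrix X X ℂ) a b :=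
    (continuous_apply_apply a b).comp continuous_subtype_val
  simp only [tensorPowConj, tensorPow, Matrix.kroneckerMap_apply, Matrix.of_apply,
    Matrix.map_apply]
  exact (continuous_finsetProd _ fun _ _ => h _ _).mul
    (continuous_finsetProd _ fun _ _ => Complex.continuous_conj.comp (h _ _))

theorem integrable_tensorPowConj (k : ℕ) (x y : (Fin k → X) × (Fin k → X)) :
    Integrable (fun U : Matrix.unitaryGroup X ℂ => tensorPowConj k (U : Matrix X X ℂ) x y)
      (unitaryHaar X) :=
  (continuous_tensorPowConj k x y).integrable_of_hasCompactSupport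
    (HasCompactSupport.of_compactSpace _)

/-- Left invariance of Haar measure under the translation `U ↦ V U`: every column of the moment
operator is an invariant tensor. -/
theorem tensorPowConj_mul_haarMoment (k : ℕ) (V : Matrix.unitaryGroup X ℂ) :
    tensorPowConj k (V : Matrix X X ℂ) * haarMoment X k = haarMoment X k := by
  ext x y
  simp only [haarMoment, Matrix.mul_apply, Matrix.of_apply]
  simp_rw [← integral_const_mul]
  rw [← integral_finsetSum _ fun z _ => (integrable_tensorPowConj k z y).const_mul _]
  rw [← integral_mul_left_eq_self (μ := unitaryHaar X)
    (fun U : Matrix.unitaryGroup X ℂ => tensorPowConj k (U : Matrix X X ℂ) x y) V]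
  simp only [Submonoid.coe_mul, tensorPowConj_mul, Matrix.mul_apply]

/-- A vector fixed by all `A^{⊗ k,k}` from the left is fixed by the moment operator. -/
theorem vecMul_haarMoment (k : ℕ) (τ : (Fin k → X) × (Fin k → X) → ℂ)
    (h : ∀ U : Matrix.unitaryGroup X ℂ, Matrix.vecMul τ (tensorPowConj k (U : Matrix X X ℂ)) = τ) :
    Matrix.vecMul τ (haarMoment X k) = τ := by
  ext y
  have h' := fun U => congrFun (h U) y
  simp only [Matrix.vecMul, dotProduct, haarMoment, Matrix.of_apply] at h' ⊢
  simp_rw [← integral_const_mul]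
  rw [← integral_finsetSum _ fun z _ => (integrable_tensorPowConj k z y).const_mul _]
  simp [h']

theorem sum_pair {X : Type} [Fintype X] {M : Type*} [AddCommMonoid M] (g : (Fin 2 → X) × (Fin 2 → X) → M) :
    ∑ z, g z = ∑ a, ∑ b, ∑ c, ∑ e, g (![a, b], ![c, e]) := by
  rw [Fintype.sum_prod_type]
  simp only [← (finTwoArrowEquiv X).symm.sum_comp, Fintype.sum_prod_type]
  rfl

/-- The vectorized permutation operator on two copies: the identity (`s = 0`) or the swap. -/
def permVec {X : Type} [DecidableEq X] (s : Fin 2) (x : (Fin 2 → X) × (Fin 2 → X)) : ℂ :=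
  if x.1 0 = x.2 s ∧ x.1 1 = x.2 (s + 1) then 1 else 0

theorem tensorPowConj_two_apply {X : Type} (A : Matrix X X ℂ) (a b c e a' b' c' e' : X) :
    tensorPowConj 2 A (![a, b], ![c, e]) (![a', b'], ![c', e']) =
      A a a' * A b b' * (star (A c c') * star (A e e')) := by
  simp [tensorPowConj, tensorPow, Fin.prod_univ_two]

theorem unitary_col_sum (U : Matrix.unitaryGroup X ℂ) (b c : X) :
    ∑ a, (U : Matrix X X ℂ) a b * star ((U : Matrix X X ℂ) a c) = if b = c then 1 else 0 := by
  have h := congrFun (congrFun (Matrix.UnitaryGroup.star_mul_self U) c) b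
  rw [Matrix.mul_apply, Matrix.one_apply] at h
  simp only [Matrix.star_apply, eq_comm (a := c)] at h
  rw [← h]
  exact Finset.sum_congr rfl fun _ _ => mul_comm _ _

/-- Each `U` is contracted with a conjugate `U` along their common row index, so orthonormality of
the columns returns the same pattern of Kronecker deltas. -/
theorem vecMul_permVec (s : Fin 2) (U : Matrix.unitaryGroup X ℂ) :
    Matrix.vecMul (permVec s) (tensorPowConj 2 (U : Matrix X X ℂ)) = permVec s := by
  ext ⟨y, z⟩
  obtain ⟨⟨a, b⟩, rfl⟩ := (finTwoArrowEquiv X).symm.surjective y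
  obtain ⟨⟨c, e⟩, rfl⟩ := (finTwoArrowEquiv X).symm.surjective z
  change Matrix.vecMul (permVec s) (tensorPowConj 2 (U : Matrix X X ℂ)) (![a, b], ![c, e]) =
    permVec s (![a, b], ![c, e])
  simp only [Matrix.vecMul, dotProduct, sum_pair, tensorPowConj_two_apply, permVec]
  have hac := unitary_col_sum U a c
  have hae := unitary_col_sum U a e
  have hbc := unitary_col_sum U b c
  have hbe := unitary_col_sum U b e
  fin_cases s
  · simp [ite_and]
    calc _ = (∑ x, (U : Matrix X X ℂ) x a * star ((U : Matrix X X ℂ) x c)) *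
          ∑ x, (U : Matrix X X ℂ) x b * star ((U : Matrix X X ℂ) x e) := by
          rw [Finset.sum_mul_sum]
          refine Finset.sum_congr rfl fun _ _ => Finset.sum_congr rfl fun _ _ => ?_
          simp; ring
      _ = _ := by rw [hac, hbe]; split_ifs <;> simp
  · simp [ite_and]
    calc _ = (∑ x, (U : Matrix X X ℂ) x a * star ((U : Matrix X X ℂ) x e)) *
          ∑ x, (U : Matrix X X ℂ) x b * star ((U : Matrix X X ℂ) x c) := by
          rw [Finset.sum_mul_sum]
          refine Finset.sum_congr rfl fun _ _ => Finset.sum_congr rfl fun _ _ => ?_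
          simp; ring
      _ = _ := by rw [hae, hbc]; split_ifs <;> simp

theorem sum_permVec_mul (s r : Fin 2) :
    ∑ x : (Fin 2 → X) × (Fin 2 → X), permVec s x * permVec r x =
      if s = r then (Fintype.card X : ℂ) ^ 2 else Fintype.card X := by
  rw [sum_pair]
  fin_cases s <;> fin_cases r <;> simp [permVec, ite_and, sq]

end

/-! ### Invariant tensors and the Weingarten formula for two copies. -/

noncomputable section

open MeasureTheory

variable {X : Type} [Fintype X] [DecidableEq X]

/-- Invariance of the tensor `w` under `U ⊗ U ⊗ conj U ⊗ conj U` for all unitary `U`. -/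
def IsUnitaryInvariant (w : X → X → X → X → ℂ) : Prop :=
  ∀ U ∈ Matrix.unitaryGroup X ℂ, ∀ a b c e, ∑ a', ∑ b', ∑ c', ∑ e',
    U a a' * U b b' * (star (U c c') * star (U e e')) * w a' b' c' e' = w a b c e

namespace IsUnitaryInvariant

variable {w : X → X → X → X → ℂ}

theorem phase (hw : IsUnitaryInvariant w) (φ : X → ℂ) (hφ : ∀ x, φ x * star (φ x) = 1)
    (a b c e : X) : φ a * φ b * (star (φ c) * star (φ e)) * w a b c e = w a b c e := by
  have hU : Matrix.diagonal φ ∈ Matrix.unitaryGroup X ℂ := by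
    rw [Matrix.mem_unitaryGroup_iff, Matrix.star_eq_conjTranspose, Matrix.diagonal_conjTranspose,
      Matrix.diagonal_mul_diagonal, ← Matrix.diagonal_one]
    exact congrArg Matrix.diagonal (funext hφ)
  have h := hw _ hU a b c e
  simp only [Matrix.diagonal_apply] at h
  simpa [ite_mul, mul_ite, apply_ite (starRingEnd ℂ)] using h

/-- Diagonal unitaries preserve `w`, so an entry survives only if the multisets `{a, b}` and `{c,
e}` agree. Multiplicities of a label differ by at most 2, so the phase `i` on a single label already
detects a mismatch. -/
theorem eq_zero (hw : IsUnitaryInvariant w) {a b c e : X} (h1 : ¬(a = c ∧ b = e))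
    (h2 : ¬(a = e ∧ b = c)) : w a b c e = 0 := by
  by_contra h0
  have key (p : X) := mul_right_cancel₀ h0 ((hw.phase (fun x => if x = p then Complex.I else 1)
    (fun x => by by_cases h : x = p <;> simp [h]) a b c e).trans (one_mul _).symm)
  have hI : Complex.I ≠ 1 := fun h => by simpa using congrArg Complex.re h
  have hn : (-1 : ℂ) ≠ 1 := by norm_num
  by_cases hac : a = c
  · have hbe : e ≠ b := fun h => h1 ⟨hac, h.symm⟩
    have h := key b
    subst hac
    by_cases hab : a = b <;> simp [hab, hbe, hI] at h
  · by_cases hae : a = e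
    · have hbc : c ≠ b := fun h => h2 ⟨hae, h.symm⟩
      have h := key b
      subst hae
      by_cases hab : a = b <;> simp [hab, hbc, hI] at h
    · have h := key a
      by_cases hab : b = a <;> simp [hab, Ne.symm hac, Ne.symm hae, hI, hn] at h

theorem perm (hw : IsUnitaryInvariant w) (π : Equiv.Perm X) (a b c e : X) :
    w (π a) (π b) (π c) (π e) = w a b c e := by
  have hU : (Matrix.of fun x y => if π x = y then (1 : ℂ) else 0) ∈ Matrix.unitaryGroup X ℂ := by
    rw [Matrix.mem_unitaryGroup_iff]
    ext x y
    simp [Matrix.mul_apply, Matrix.one_apply, apply_ite (starRingEnd ℂ), eq_comm]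
  have h := hw _ hU a b c e
  simpa [ite_mul, mul_ite, apply_ite (starRingEnd ℂ)] using h

/-- The Householder reflection in `u = e_p + 2 e_r`, where `u · u = 5`; the 3-4-5 triple keeps its
entries rational, and it is the one unitary needed that mixes basis labels. -/
theorem reflection_row (p r : X) (hpr : p ≠ r) :
    ∃ U ∈ Matrix.unitaryGroup X ℂ, ∀ g : X → ℂ,
      ∑ y, U p y * g y = 3 / 5 * g p - 4 / 5 * g r ∧
      ∑ y, star (U p y) * g y = 3 / 5 * g p - 4 / 5 * g r := by
  set u : X → ℂ := fun x => (if x = p then 1 else 0) + (if x = r then 2 else 0) with hu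
  have hsu : star u = u := by
    ext x
    simp only [hu, Pi.star_apply, star_add, apply_ite star, star_one, star_zero, star_ofNat]
  have huu : u ⬝ᵥ u = 5 := by
    simp [hu, dotProduct, add_mul, mul_add, Finset.sum_add_distrib, hpr, hpr.symm]
    norm_num
  refine ⟨1 - (2 / 5 : ℂ) • Matrix.vecMulVec u u, ?_, fun g => ?_⟩
  · have hs : star (1 - (2 / 5 : ℂ) • Matrix.vecMulVec u u) =
        1 - (2 / 5 : ℂ) • Matrix.vecMulVec u u := by
      rw [Matrix.star_eq_conjTranspose, Matrix.conjTranspose_sub, Matrix.conjTranspose_smul,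
        Matrix.conjTranspose_vecMulVec, hsu, Matrix.conjTranspose_one]
      norm_num [star_div₀]
    rw [Matrix.mem_unitaryGroup_iff, hs, mul_sub, mul_one, sub_mul, one_mul, smul_mul_smul_comm,
      Matrix.vecMulVec_mul_vecMulVec, huu, Matrix.vecMulVec_smul, smul_smul]
    module
  · have hpu : u p = 1 := by simp [hu, hpr]
    have h (y : X) : (1 - (2 / 5 : ℂ) • Matrix.vecMulVec u u) p y =
        (if y = p then 3 / 5 else 0) - (if y = r then 4 / 5 else 0) := by
      simp only [Matrix.sub_apply, Matrix.one_apply, Matrix.smul_apply, Matrix.vecMulVec_apply, hpu]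
      simp only [hu, smul_eq_mul]
      by_cases h1 : y = p
      · subst h1; simp [hpr]; norm_num
      · by_cases h2 : y = r
        · subst h2; simp [h1, hpr]; norm_num
        · simp [h1, h2, Ne.symm h1]
    simp only [h]
    constructor <;>
    simp [sub_mul, Finset.sum_sub_distrib, apply_ite star]

theorem diag_eq (hw : IsUnitaryInvariant w) {p r : X} (hpr : p ≠ r) :
    w p p p p = w p r p r + w p r r p := by
  obtain ⟨U, hU, hrow⟩ := reflection_row p r hpr
  have h := hw U hU p p p p
  simp only [mul_assoc, ← Finset.mul_sum] at h
  simp only [hrow] at h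
  have z {a b c e : X} (h1 : ¬(a = c ∧ b = e)) (h2 : ¬(a = e ∧ b = c)) := hw.eq_zero h1 h2
  have hrp := hpr.symm
  have hsw (a b c e : X) := hw.perm (Equiv.swap p r) a b c e
  have e1 := hsw r r r r
  have e2 := hsw r p r p
  have e3 := hsw r p p r
  simp only [Equiv.swap_apply_left, Equiv.swap_apply_right] at e1 e2 e3
  rw [z (a := p) (b := p) (c := p) (e := r) (by simp [hpr]) (by simp [hpr]),
    z (a := p) (b := p) (c := r) (e := p) (by simp [hpr]) (by simp [hpr]),
    z (a := p) (b := p) (c := r) (e := r) (by simp [hpr]) (by simp [hpr]),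
    z (a := p) (b := r) (c := p) (e := p) (by simp [hrp]) (by simp [hrp]),
    z (a := p) (b := r) (c := r) (e := r) (by simp [hpr]) (by simp [hpr]),
    z (a := r) (b := p) (c := p) (e := p) (by simp [hrp]) (by simp [hrp]),
    z (a := r) (b := p) (c := r) (e := r) (by simp [hpr]) (by simp [hpr]),
    z (a := r) (b := r) (c := p) (e := p) (by simp [hrp]) (by simp [hrp]),
    z (a := r) (b := r) (c := p) (e := r) (by simp [hrp]) (by simp [hrp]),
    z (a := r) (b := r) (c := r) (e := p) (by simp [hrp]) (by simp [hrp]),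
    ← e1, ← e2, ← e3] at h
  -- The surviving terms have weights `(3⁴ + 4⁴)/5⁴ = 337/625` on the diagonal entry and `2 ·
  -- 144/625` on the two mixed ones, and `1 - 337/625 = 288/625`.
  linear_combination (-625 / 288) * h

theorem exists_perm {X : Type} [DecidableEq X] {p r a b : X} (hpr : p ≠ r) (hab : a ≠ b) :
    ∃ π : Equiv.Perm X, π p = a ∧ π r = b := by
  refine ⟨Equiv.swap (Equiv.swap p a r) b * Equiv.swap p a, ?_, by simp⟩
  rw [Equiv.Perm.mul_apply, Equiv.swap_apply_left, Equiv.swap_apply_of_ne_of_ne _ hab]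
  intro h
  exact hpr ((Equiv.swap p a).injective (by rw [Equiv.swap_apply_left]; exact h))

/-- An invariant tensor is a combination of the two permutation operators. -/
theorem exists_coeff (hw : IsUnitaryInvariant w) [Nontrivial X] :
    ∃ x y : ℂ, ∀ a b c e, w a b c e =
      x * (if a = c ∧ b = e then 1 else 0) + y * (if a = e ∧ b = c then 1 else 0) := by
  obtain ⟨p, r, hpr⟩ := exists_pair_ne X
  have hoff {a b : X} (hab : a ≠ b) : w a b a b = w p r p r ∧ w a b b a = w p r r p := by
    obtain ⟨π, rfl, rfl⟩ := exists_perm hpr hab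
    exact ⟨hw.perm π _ _ _ _, hw.perm π _ _ _ _⟩
  refine ⟨w p r p r, w p r r p, fun a b c e => ?_⟩
  by_cases h1 : a = c ∧ b = e
  · obtain ⟨rfl, rfl⟩ := h1
    by_cases hab : a = b
    · subst hab
      obtain ⟨b, hb⟩ := exists_ne a
      simp [hw.diag_eq hb.symm, hoff hb.symm]
    · simp [hoff hab, hab]
  · by_cases h2 : a = e ∧ b = c
    · obtain ⟨rfl, rfl⟩ := h2
      have hab : a ≠ b := fun h => h1 ⟨h, h.symm⟩
      simp [hoff hab, hab]
    · simp [hw.eq_zero h1 h2, h1, h2]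

end IsUnitaryInvariant

/-- The Weingarten matrix of two copies in dimension `d`. -/
def weingarten (d : ℂ) (s r : Fin 2) : ℂ :=
  if s = r then 1 / (d ^ 2 - 1) else -1 / (d * (d ^ 2 - 1))

theorem haarMoment_two_apply [Nontrivial X] (x y : (Fin 2 → X) × (Fin 2 → X)) :
    haarMoment X 2 x y =
      ∑ s, ∑ r, weingarten (Fintype.card X) s r * permVec s x * permVec r y := by
  set w : X → X → X → X → ℂ := fun a b c e => haarMoment X 2 (![a, b], ![c, e]) y with hwdef
  have hw : IsUnitaryInvariant w := by
    intro U hU a b c e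
    have h := congrFun (congrFun (tensorPowConj_mul_haarMoment 2 ⟨U, hU⟩) (![a, b], ![c, e])) y
    rw [Matrix.mul_apply, sum_pair] at h
    simpa only [tensorPowConj_two_apply] using h
  obtain ⟨α, β, hαβ⟩ := hw.exists_coeff
  have hcol (x : (Fin 2 → X) × (Fin 2 → X)) :
      haarMoment X 2 x y = α * permVec 0 x + β * permVec 1 x := by
    obtain ⟨x1, x2⟩ := x
    obtain ⟨⟨a, b⟩, rfl⟩ := (finTwoArrowEquiv X).symm.surjective x1
    obtain ⟨⟨c, e⟩, rfl⟩ := (finTwoArrowEquiv X).symm.surjective x2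
    exact (hαβ a b c e).trans (by simp [permVec])
  -- Pairing the column with the two fixed vectors gives a 2 × 2 system for `α`, `β` whose matrix is
  -- the Gram matrix; `weingarten` is its inverse.
  have hpair (s : Fin 2) : permVec s y = α * (∑ x : (Fin 2 → X) × (Fin 2 → X),
      permVec s x * permVec 0 x) + β * ∑ x : (Fin 2 → X) × (Fin 2 → X),
        permVec s x * permVec 1 x := by
    have h := congrFun (vecMul_haarMoment 2 (permVec s) (vecMul_permVec (X := X) s)) y
    simp only [Matrix.vecMul, dotProduct, hcol] at h
    rw [← h, Finset.mul_sum, Finset.mul_sum, ← Finset.sum_add_distrib]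
    exact Finset.sum_congr rfl fun _ _ => by ring
  have h0 := hpair 0
  have h1 := hpair 1
  simp only [sum_permVec_mul] at h0 h1
  simp only [if_true, Fin.isValue, zero_ne_one, one_ne_zero, if_false] at h0 h1
  have hd : (1 : ℝ) < Fintype.card X := by exact_mod_cast Fintype.one_lt_card
  have hd0 : (Fintype.card X : ℂ) ≠ 0 := by
    have : (Fintype.card X : ℝ) ≠ 0 := by positivity
    exact_mod_cast this
  have hd1 : (Fintype.card X : ℂ) ^ 2 - 1 ≠ 0 := by
    have : (Fintype.card X : ℝ) ^ 2 - 1 ≠ 0 := by nlinarith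
    exact_mod_cast this
  rw [hcol x]
  simp only [Fin.sum_univ_two, weingarten, h0, h1]
  simp only [if_true, Fin.isValue, zero_ne_one, one_ne_zero, if_false]
  field_simp
  ring

end

/-! ### The finite linear systems satisfied by the pairings. -/

noncomputable section

theorem eq_zero_of_coupled {t α x y : ℝ} (hα : 0 ≤ α) (ht : 2 < t)
    (hμ : 4 * α ^ 2 < (t - 1) * (t - 2)) (hx : 0 ≤ x) (hy : 0 ≤ y)
    (h₁ : (t - 2) * x = α * y) (h₂ : (t - 1) * y ≤ α * (4 * x)) : x = 0 ∧ y = 0 := by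
  have hx0 : x = 0 := by
    have h4 : (t - 1) * (t - 2) * x ≤ 4 * α ^ 2 * x := by
      calc (t - 1) * (t - 2) * x = α * ((t - 1) * y) := by linear_combination (t - 1) * h₁
        _ ≤ α * (α * (4 * x)) := mul_le_mul_of_nonneg_left h₂ hα
        _ = _ := by ring
    nlinarith
  refine ⟨hx0, ?_⟩
  rw [hx0] at h₂
  nlinarith

/-- Constant configurations decouple because `t ≠ 3`. Configurations with one and with two leaves
differing from the centre are coupled only to each other; summing norms over the six of each kind
reduces to `eq_zero_of_coupled`. Those with three differing leaves are then determined by the rest.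
-/
theorem fin_two_four_eq_zero {t α : ℝ} (hα : 0 ≤ α) (ht : 2 < t) (ht3 : t ≠ 3)
    (hμ : 4 * α ^ 2 < (t - 1) * (t - 2)) (f : Fin 2 → Fin 2 → Fin 2 → Fin 2 → ℂ)
    (hf : ∀ s₁ s₂ s₃ s₄, (t : ℂ) * f s₁ s₂ s₃ s₄ =
      (if s₁ = s₄ then f s₁ s₂ s₃ s₄ else α * (f 0 s₂ s₃ 0 + f 1 s₂ s₃ 1)) +
      (if s₂ = s₄ then f s₁ s₂ s₃ s₄ else α * (f s₁ 0 s₃ 0 + f s₁ 1 s₃ 1)) +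
      (if s₃ = s₄ then f s₁ s₂ s₃ s₄ else α * (f s₁ s₂ 0 0 + f s₁ s₂ 1 1)))
    (s₁ s₂ s₃ s₄ : Fin 2) : f s₁ s₂ s₃ s₄ = 0 := by
  have h3 : (t : ℂ) - 3 ≠ 0 := by exact_mod_cast sub_ne_zero.mpr ht3
  have cst (s : Fin 2) : f s s s s = 0 := by
    have h := hf s s s s
    simp only [if_true] at h
    exact (mul_eq_zero.mp (show ((t : ℂ) - 3) * f s s s s = 0 by linear_combination h)).resolve_left
      h3
  have z0 := cst 0
  have z1 := cst 1
  have one_step {x y : ℂ} (h : ((t : ℂ) - 2) * x = α * y) : (t - 2) * ‖x‖ = α * ‖y‖ := by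
    have := congrArg norm h
    rwa [norm_mul, norm_mul, Complex.norm_real, Real.norm_of_nonneg hα,
      show (t : ℂ) - 2 = ((t - 2 : ℝ) : ℂ) by push_cast; rfl, Complex.norm_real,
      Real.norm_of_nonneg (by linarith)] at this
  have two_step {x y z w : ℂ} (h : ((t : ℂ) - 1) * x = α * (y + z + w + z)) :
      (t - 1) * ‖x‖ ≤ α * (‖y‖ + 2 * ‖z‖ + ‖w‖) := by
    have := congrArg norm h
    rw [norm_mul, norm_mul, Complex.norm_real, Real.norm_of_nonneg hα,
      show (t : ℂ) - 1 = ((t - 1 : ℝ) : ℂ) by push_cast; rfl, Complex.norm_real,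
      Real.norm_of_nonneg (by linarith)] at this
    rw [this]
    refine mul_le_mul_of_nonneg_left ?_ hα
    linarith [norm_add_le (y + z + w) z, norm_add_le (y + z) w, norm_add_le y z]
  have a1 := hf 1 0 0 0
  have a2 := hf 0 1 0 0
  have a3 := hf 0 0 1 0
  have a4 := hf 0 1 1 1
  have a5 := hf 1 0 1 1
  have a6 := hf 1 1 0 1
  have b1 := hf 1 0 0 1
  have b2 := hf 0 1 0 1
  have b3 := hf 0 0 1 1
  have b4 := hf 0 1 1 0
  have b5 := hf 1 0 1 0
  have b6 := hf 1 1 0 0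
  have c1 := hf 1 1 1 0
  have c2 := hf 0 0 0 1
  simp only [if_true, Fin.isValue, zero_ne_one, one_ne_zero, if_false, z0, z1, zero_add,
    add_zero] at a1 a2 a3 a4 a5 a6 b1 b2 b3 b4 b5 b6 c1 c2
  have a1' := one_step (x := f 1 0 0 0) (y := f 1 0 0 1) (by linear_combination a1)
  have a2' := one_step (x := f 0 1 0 0) (y := f 0 1 0 1) (by linear_combination a2)
  have a3' := one_step (x := f 0 0 1 0) (y := f 0 0 1 1) (by linear_combination a3)
  have a4' := one_step (x := f 0 1 1 1) (y := f 0 1 1 0) (by linear_combination a4)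
  have a5' := one_step (x := f 1 0 1 1) (y := f 1 0 1 0) (by linear_combination a5)
  have a6' := one_step (x := f 1 1 0 1) (y := f 1 1 0 0) (by linear_combination a6)
  have b1' := two_step (x := f 1 0 0 1) (y := f 1 1 0 1) (z := f 1 0 0 0) (w := f 1 0 1 1)
    (by linear_combination b1)
  have b2' := two_step (x := f 0 1 0 1) (y := f 1 1 0 1) (z := f 0 1 0 0) (w := f 0 1 1 1)
    (by linear_combination b2)
  have b3' := two_step (x := f 0 0 1 1) (y := f 1 0 1 1) (z := f 0 0 1 0) (w := f 0 1 1 1)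
    (by linear_combination b3)
  have b4' := two_step (x := f 0 1 1 0) (y := f 0 0 1 0) (z := f 0 1 1 1) (w := f 0 1 0 0)
    (by linear_combination b4)
  have b5' := two_step (x := f 1 0 1 0) (y := f 0 0 1 0) (z := f 1 0 1 1) (w := f 1 0 0 0)
    (by linear_combination b5)
  have b6' := two_step (x := f 1 1 0 0) (y := f 0 1 0 0) (z := f 1 1 0 1) (w := f 1 0 0 0)
    (by linear_combination b6)
  set N₁ := ‖f 1 0 0 0‖ + ‖f 0 1 0 0‖ + ‖f 0 0 1 0‖ + ‖f 0 1 1 1‖ + ‖f 1 0 1 1‖ + ‖f 1 1 0 1‖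
    with hN₁
  set N₂ := ‖f 1 0 0 1‖ + ‖f 0 1 0 1‖ + ‖f 0 0 1 1‖ + ‖f 0 1 1 0‖ + ‖f 1 0 1 0‖ + ‖f 1 1 0 0‖
    with hN₂
  have e1 : (t - 2) * N₁ = α * N₂ := by
    rw [hN₁, hN₂]; linear_combination a1' + a2' + a3' + a4' + a5' + a6'
  -- Each one-leaf norm occurs with total weight 4 over the six inequalities.
  have e2 : (t - 1) * N₂ ≤ α * (4 * N₁) := by
    rw [hN₁, hN₂]; linarith [b1', b2', b3', b4', b5', b6']
  have p1 : 0 ≤ N₁ := by positivity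
  have p2 : 0 ≤ N₂ := by positivity
  obtain ⟨n1, n2⟩ := eq_zero_of_coupled hα ht hμ p1 p2 e1 e2
  rw [hN₁] at n1
  rw [hN₂] at n2
  repeat rw [add_eq_zero_iff_of_nonneg (by positivity) (by positivity)] at n1
  repeat rw [add_eq_zero_iff_of_nonneg (by positivity) (by positivity)] at n2
  simp only [norm_eq_zero] at n1 n2
  obtain ⟨⟨⟨⟨⟨u1, u2⟩, u3⟩, u4⟩, u5⟩, u6⟩ := n1
  obtain ⟨⟨⟨⟨⟨v1, v2⟩, v3⟩, v4⟩, v5⟩, v6⟩ := n2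
  have ht0 : (t : ℂ) ≠ 0 := by exact_mod_cast (by linarith : t ≠ 0)
  simp only [v1, v2, v3, v4, v5, v6, add_zero, mul_zero, mul_eq_zero, ht0, false_or] at c1 c2
  clear hf a1 a2 a3 a4 a5 a6 b1 b2 b3 b4 b5 b6 a1' a2' a3' a4' a5' a6' b1' b2' b3' b4' b5' b6'
  match s₁, s₂, s₃, s₄ with
  | 0, 0, 0, 0 => exact z0
  | 1, 1, 1, 1 => exact z1
  | 1, 0, 0, 0 => exact u1
  | 0, 1, 0, 0 => exact u2
  | 0, 0, 1, 0 => exact u3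
  | 0, 1, 1, 1 => exact u4
  | 1, 0, 1, 1 => exact u5
  | 1, 1, 0, 1 => exact u6
  | 1, 0, 0, 1 => exact v1
  | 0, 1, 0, 1 => exact v2
  | 0, 0, 1, 1 => exact v3
  | 0, 1, 1, 0 => exact v4
  | 1, 0, 1, 0 => exact v5
  | 1, 1, 0, 0 => exact v6
  | 1, 1, 1, 0 => exact c1
  | 0, 0, 0, 1 => exact c2

theorem fin_two_three_eq_zero {t α : ℝ} (hα : 0 ≤ α) (hα1 : α ≤ 1) (ht : 2 < t)
    (f : Fin 2 → Fin 2 → Fin 2 → ℂ)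
    (hf : ∀ s₁ s₂ s₃, (t : ℂ) * f s₁ s₂ s₃ =
      (if s₁ = s₃ then f s₁ s₂ s₃ else α * (f 0 s₂ 0 + f 1 s₂ 1)) +
      (if s₂ = s₃ then f s₁ s₂ s₃ else α * (f s₁ 0 0 + f s₁ 1 1)))
    (s₁ s₂ s₃ : Fin 2) : f s₁ s₂ s₃ = 0 := by
  have h2 : (t : ℂ) - 2 ≠ 0 := by exact_mod_cast (by linarith : t - 2 ≠ 0)
  have ht0 : (t : ℂ) ≠ 0 := by exact_mod_cast (by linarith : t ≠ 0)
  have cst (s : Fin 2) : f s s s = 0 := by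
    have h := hf s s s
    simp only [if_true] at h
    exact (mul_eq_zero.mp (show ((t : ℂ) - 2) * f s s s = 0 by linear_combination h)).resolve_left
      h2
  have z0 := cst 0
  have z1 := cst 1
  -- The coupling matrix has eigenvalues `1 ± α`, at most 2 since `α ≤ 1`.
  have pair {x y : ℂ} (hx : (t : ℂ) * x = x + α * y) (hy : (t : ℂ) * y = y + α * x) :
      x = 0 ∧ y = 0 := by
    have hm : (((t - 1) ^ 2 - α ^ 2 : ℝ) : ℂ) ≠ 0 := by
      exact_mod_cast (by nlinarith : (t - 1) ^ 2 - α ^ 2 ≠ 0)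
    push_cast at hm
    constructor
    · refine (mul_eq_zero.mp ?_).resolve_left hm
      linear_combination ((t : ℂ) - 1) * hx + α * hy
    · refine (mul_eq_zero.mp ?_).resolve_left hm
      linear_combination ((t : ℂ) - 1) * hy + α * hx
  have a1 := hf 1 0 0
  have a2 := hf 1 0 1
  have a3 := hf 0 1 0
  have a4 := hf 0 1 1
  have c1 := hf 1 1 0
  have c2 := hf 0 0 1
  simp only [if_true, Fin.isValue, zero_ne_one, one_ne_zero, if_false, z0, z1, zero_add,
    add_zero] at a1 a2 a3 a4 c1 c2
  obtain ⟨u1, u2⟩ := pair (x := f 1 0 0) (y := f 1 0 1) (by linear_combination a1)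
    (by linear_combination a2)
  obtain ⟨u3, u4⟩ := pair (x := f 0 1 0) (y := f 0 1 1) (by linear_combination a3)
    (by linear_combination a4)
  simp only [u1, u2, u3, u4, add_zero, mul_zero, mul_eq_zero, ht0, false_or] at c1 c2
  match s₁, s₂, s₃ with
  | 0, 0, 0 => exact z0
  | 1, 1, 1 => exact z1
  | 1, 0, 0 => exact u1
  | 1, 0, 1 => exact u2
  | 0, 1, 0 => exact u3
  | 0, 1, 1 => exact u4
  | 1, 1, 0 => exact c1
  | 0, 0, 1 => exact c2

end

/-! ### Pairings of tensors with permutation vectors, and exclusion of eigenvalues. -/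

noncomputable section

variable {L : Type} [Fintype L]

/-- The Gram matrix of the two permutation operators on two copies in dimension `q`. -/
def permGram (q : ℕ) (s r : Fin 2) : ℂ := if s = r then (q : ℂ) ^ 2 else q

/-- The overlap coefficient `q / (q² + 1)` of the two-site projector. -/
def overlap (q : ℕ) : ℝ := q / ((q : ℝ) ^ 2 + 1)

/-- The action of the projector on `σ s₁ ⊗ σ s₂`, in coordinates: Weingarten weights in dimension
`q²` against one-site Gram matrices in dimension `q`. When `s₁ ≠ s₂` both Gram products are `q³`,
whence the common factor `overlap q`. -/
theorem weingarten_permGram {q : ℕ} (hq : 2 ≤ q) (C : Fin 2 → ℂ) (s₁ s₂ : Fin 2) :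
    ∑ s, ∑ r, weingarten ((q : ℂ) ^ 2) s r * (permGram q s₁ s * permGram q s₂ s) * C r =
      if s₁ = s₂ then C s₁ else overlap q * (C 0 + C 1) := by
  have hq' : (2 : ℝ) ≤ q := by exact_mod_cast hq
  have h0 : (q : ℂ) ≠ 0 := by
    exact_mod_cast (by linarith : (q : ℝ) ≠ 0)
  have h1 : (q : ℂ) ^ 2 + 1 ≠ 0 := by
    exact_mod_cast (by positivity : (q : ℝ) ^ 2 + 1 ≠ 0)
  have h2 : ((q : ℂ) ^ 2) ^ 2 - 1 ≠ 0 := by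
    have h4 : (4 : ℝ) ≤ (q : ℝ) ^ 2 := by nlinarith
    have : ((q : ℝ) ^ 2) ^ 2 - 1 ≠ 0 := by nlinarith
    exact_mod_cast this
  have h3 : (q : ℂ) ^ 2 - 1 ≠ 0 := fun h => h2 (by linear_combination ((q : ℂ) ^ 2 + 1) * h)
  have h4 : ((q : ℂ) ^ 2) ^ 2 - 1 = ((q : ℂ) ^ 2 - 1) * ((q : ℂ) ^ 2 + 1) := by ring
  match s₁, s₂ with
  | 0, 0 | 0, 1 | 1, 0 | 1, 1 =>
    simp only [Fin.sum_univ_two, weingarten, permGram, overlap, if_true, Fin.isValue, zero_ne_one,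
      one_ne_zero, if_false, h4]
    push_cast
    field_simp
    ring

variable (σ : Fin 2 → L → ℂ) (q : ℕ)

/-- The bilinear pairing of a two-site tensor with `σ s ⊗ σ r`. -/
def pairing (s r : Fin 2) (u : L → L → ℂ) : ℂ := ∑ a, ∑ d, σ s a * σ r d * u a d

/-- The two-site moment operator, written on tensors of two sites. -/
def pairProj (u : L → L → ℂ) (a d : L) : ℂ :=
  ∑ s, ∑ r, weingarten ((q : ℂ) ^ 2) s r * (σ s a * σ s d) * pairing σ r r u

variable {σ q}

theorem sum_sum_mul_mul (s₁ s₂ s : Fin 2) (k C : ℂ)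
    (hσ : ∀ s r, ∑ a, σ s a * σ r a = permGram q s r) :
    ∑ a, ∑ d, σ s₁ a * σ s₂ d * (k * (σ s a * σ s d) * C) =
      k * (permGram q s₁ s * permGram q s₂ s) * C := by
  rw [← hσ, ← hσ, Finset.sum_mul_sum, Finset.mul_sum, Finset.sum_mul]
  refine Finset.sum_congr rfl fun a _ => ?_
  rw [Finset.mul_sum, Finset.sum_mul]
  exact Finset.sum_congr rfl fun d _ => by ring

/-- The projector is symmetric, so it can be moved onto `σ s ⊗ σ r`. -/
theorem pairing_pairProj (hq : 2 ≤ q) (hσ : ∀ s r, ∑ a, σ s a * σ r a = permGram q s r)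
    (u : L → L → ℂ) (s r : Fin 2) :
    pairing σ s r (pairProj σ q u) =
      if s = r then pairing σ s s u else overlap q * (pairing σ 0 0 u + pairing σ 1 1 u) := by
  rw [← weingarten_permGram hq (fun r => pairing σ r r u) s r]
  rw [pairing]
  simp only [pairProj, Finset.mul_sum (s := Finset.univ (α := Fin 2))]
  simp_rw [Finset.sum_comm (s := Finset.univ (α := L)) (t := Finset.univ (α := Fin 2)),
    sum_sum_mul_mul _ _ _ _ _ hσ]

variable (σ) in
/-- The pairing of a three-site tensor with `σ s₁ ⊗ σ s₂ ⊗ σ s₃`. -/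
def triPairing (s₁ s₂ s₃ : Fin 2) (u : L → L → L → ℂ) : ℂ :=
  ∑ a, σ s₁ a * pairing σ s₂ s₃ (u a)

theorem triPairing_eq (s₁ s₂ s₃ : Fin 2) (u : L → L → L → ℂ) :
    triPairing σ s₁ s₂ s₃ u = ∑ b, σ s₂ b * pairing σ s₁ s₃ fun a d => u a b d := by
  simp only [triPairing, pairing, Finset.mul_sum]
  rw [Finset.sum_comm]
  exact Finset.sum_congr rfl fun _ _ => Finset.sum_congr rfl fun _ _ =>
    Finset.sum_congr rfl fun _ _ => by ring

variable (σ) in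
/-- The pairing of a four-site tensor with `σ s₁ ⊗ σ s₂ ⊗ σ s₃ ⊗ σ s₄`. -/
def quadPairing (s₁ s₂ s₃ s₄ : Fin 2) (v : L → L → L → L → ℂ) : ℂ :=
  ∑ c, σ s₃ c * triPairing σ s₁ s₂ s₄ fun a b d => v a b c d

theorem quadPairing_eq (s₁ s₂ s₃ s₄ : Fin 2) (v : L → L → L → L → ℂ) :
    quadPairing σ s₁ s₂ s₃ s₄ v = ∑ a, σ s₁ a * ∑ b, σ s₂ b * pairing σ s₃ s₄ (v a b) := by
  simp only [quadPairing, triPairing, pairing, Finset.mul_sum]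
  rw [Finset.sum_comm]
  refine Finset.sum_congr rfl fun a _ => ?_
  rw [Finset.sum_comm]
  exact Finset.sum_congr rfl fun _ _ => Finset.sum_congr rfl fun _ _ =>
    Finset.sum_congr rfl fun _ _ => by ring

theorem quadPairing_swap_left (s₁ s₂ s₃ s₄ : Fin 2) (v : L → L → L → L → ℂ) :
    quadPairing σ s₁ s₂ s₃ s₄ (fun a b c d => v b a c d) = quadPairing σ s₂ s₁ s₃ s₄ v := by
  simp only [quadPairing]
  exact Finset.sum_congr rfl fun c _ => congrArg _ (triPairing_eq _ _ _ _)

theorem quadPairing_swap_right (s₁ s₂ s₃ s₄ : Fin 2) (v : L → L → L → L → ℂ) :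
    quadPairing σ s₁ s₂ s₃ s₄ (fun a b c d => v a c b d) = quadPairing σ s₁ s₃ s₂ s₄ v := by
  simp only [quadPairing, triPairing, pairing, Finset.mul_sum]
  calc _ = ∑ c, ∑ a, ∑ b, ∑ d, σ s₃ c * (σ s₁ a * (σ s₂ b * σ s₄ d * v a c b d)) := rfl
    _ = ∑ a, ∑ b, ∑ c, ∑ d, σ s₃ c * (σ s₁ a * (σ s₂ b * σ s₄ d * v a c b d)) := by
      rw [Finset.sum_comm]
      exact Finset.sum_congr rfl fun a _ => Finset.sum_comm
    _ = ∑ b, ∑ a, ∑ c, ∑ d, σ s₃ c * (σ s₁ a * (σ s₂ b * σ s₄ d * v a c b d)) := Finset.sum_comm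
    _ = _ := Finset.sum_congr rfl fun _ _ => Finset.sum_congr rfl fun _ _ =>
        Finset.sum_congr rfl fun _ _ => Finset.sum_congr rfl fun _ _ => by ring

theorem sum_mul_ite_overlap (f g : L → ℂ) (F : L → Fin 2 → ℂ) (P : Prop) [Decidable P] (k : ℂ) :
    ∑ b, f b * (if P then g b else k * (F b 0 + F b 1)) =
      if P then ∑ b, f b * g b else k * (∑ b, f b * F b 0 + ∑ b, f b * F b 1) := by
  split_ifs
  · rfl
  · rw [← Finset.sum_add_distrib, Finset.mul_sum]
    exact Finset.sum_congr rfl fun _ _ => by ring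

theorem triPairing_pairProj_right (hq : 2 ≤ q) (hσ : ∀ s r, ∑ a, σ s a * σ r a = permGram q s r)
    (u : L → L → L → ℂ) (s₁ s₂ s₃ : Fin 2) :
    triPairing σ s₁ s₂ s₃ (fun a => pairProj σ q (u a)) =
      if s₂ = s₃ then triPairing σ s₁ s₂ s₃ u else
        overlap q * (triPairing σ s₁ 0 0 u + triPairing σ s₁ 1 1 u) := by
  simp only [triPairing, pairing_pairProj hq hσ]
  rw [sum_mul_ite_overlap _ _ fun a s => pairing σ s s (u a)]
  split_ifs with h
  · rw [h]
  · rfl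

theorem triPairing_pairProj_left (hq : 2 ≤ q) (hσ : ∀ s r, ∑ a, σ s a * σ r a = permGram q s r)
    (u : L → L → L → ℂ) (s₁ s₂ s₃ : Fin 2) :
    triPairing σ s₁ s₂ s₃ (fun a b d => pairProj σ q (fun a' d' => u a' b d') a d) =
      if s₁ = s₃ then triPairing σ s₁ s₂ s₃ u else
        overlap q * (triPairing σ 0 s₂ 0 u + triPairing σ 1 s₂ 1 u) := by
  have h := triPairing_pairProj_right hq hσ (fun b a d => u a b d) s₂ s₁ s₃
  rw [triPairing_eq s₁ s₂ s₃ u, triPairing_eq 0 s₂ 0 u, triPairing_eq 1 s₂ 1 u]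
  exact (triPairing_eq _ _ _ _).trans h

theorem quadPairing_pairProj_left (hq : 2 ≤ q) (hσ : ∀ s r, ∑ a, σ s a * σ r a = permGram q s r)
    (v : L → L → L → L → ℂ) (s₁ s₂ s₃ s₄ : Fin 2) :
    quadPairing σ s₁ s₂ s₃ s₄ (fun a b c d => pairProj σ q (fun a' d' => v a' b c d') a d) =
      if s₁ = s₄ then quadPairing σ s₁ s₂ s₃ s₄ v else
        overlap q * (quadPairing σ 0 s₂ s₃ 0 v + quadPairing σ 1 s₂ s₃ 1 v) := by
  simp only [quadPairing]
  simp_rw [fun c => triPairing_pairProj_left hq hσ (fun a b d => v a b c d) s₁ s₂ s₄]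
  exact sum_mul_ite_overlap _ _ (fun c s => triPairing σ s s₂ s fun a b d => v a b c d) _ _

theorem quadPairing_pairProj_middle (hq : 2 ≤ q) (hσ : ∀ s r, ∑ a, σ s a * σ r a = permGram q s r)
    (v : L → L → L → L → ℂ) (s₁ s₂ s₃ s₄ : Fin 2) :
    quadPairing σ s₁ s₂ s₃ s₄ (fun a b c d => pairProj σ q (fun b' d' => v a b' c d') b d) =
      if s₂ = s₄ then quadPairing σ s₁ s₂ s₃ s₄ v else
        overlap q * (quadPairing σ s₁ 0 s₃ 0 v + quadPairing σ s₁ 1 s₃ 1 v) := by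
  have h := quadPairing_pairProj_left hq hσ (fun a b c d => v b a c d) s₂ s₁ s₃ s₄
  rw [quadPairing_swap_left s₂ s₁ s₃ s₄ v, quadPairing_swap_left 0 s₁ s₃ 0 v,
    quadPairing_swap_left 1 s₁ s₃ 1 v] at h
  rw [← h]
  exact (quadPairing_swap_left s₂ s₁ s₃ s₄ _).symm

theorem quadPairing_pairProj_right (hq : 2 ≤ q) (hσ : ∀ s r, ∑ a, σ s a * σ r a = permGram q s r)
    (v : L → L → L → L → ℂ) (s₁ s₂ s₃ s₄ : Fin 2) :
    quadPairing σ s₁ s₂ s₃ s₄ (fun a b c d => pairProj σ q (fun c' d' => v a b c' d') c d) =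
      if s₃ = s₄ then quadPairing σ s₁ s₂ s₃ s₄ v else
        overlap q * (quadPairing σ s₁ s₂ 0 0 v + quadPairing σ s₁ s₂ 1 1 v) := by
  have h := quadPairing_pairProj_middle hq hσ (fun a b c d => v a c b d) s₁ s₃ s₂ s₄
  rw [quadPairing_swap_right s₁ s₃ s₂ s₄ v, quadPairing_swap_right s₁ 0 s₂ 0 v,
    quadPairing_swap_right s₁ 1 s₂ 1 v] at h
  rw [← h]
  exact (quadPairing_swap_right s₁ s₃ s₂ s₄ _).symm

/-- Pairing two sites of `P_{2,4} u` only sees the triple pairings of `u`. -/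
theorem pairing_pairProj_outer (hσ : ∀ s r, ∑ a, σ s a * σ r a = permGram q s r)
    (u : L → L → L → ℂ) (s₁ s₃ : Fin 2) (b : L) :
    pairing σ s₁ s₃ (fun a d => pairProj σ q (u a) b d) =
      ∑ s, ∑ r, weingarten ((q : ℂ) ^ 2) s r * (σ s b * permGram q s₃ s) *
        triPairing σ s₁ r r u := by
  have term (Q : L → ℂ) (s : Fin 2) (k x : ℂ) :
      ∑ a, ∑ d, σ s₁ a * σ s₃ d * (k * (x * σ s d) * Q a) =
        k * (x * permGram q s₃ s) * ∑ a, σ s₁ a * Q a := by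
    rw [← hσ]
    simp only [Finset.mul_sum, Finset.sum_mul]
    exact Finset.sum_congr rfl fun _ _ => Finset.sum_congr rfl fun _ _ => by ring
  simp only [pairProj, triPairing]
  -- Shields the inner pairing from the unfolding of the outer one.
  generalize hQ : (fun a r => pairing σ r r (u a)) = Q
  have hQ' (a r) : pairing σ r r (u a) = Q a r := by rw [← hQ]
  simp only [hQ']
  simp only [pairing, Fin.sum_univ_two, mul_add, Finset.sum_add_distrib, term (fun a => Q a _)]

/-- Pairing three sites of `P_{3,4} v` only sees the full pairings of `v`. -/
theorem triPairing_pairProj_outer (hσ : ∀ s r, ∑ a, σ s a * σ r a = permGram q s r)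
    (v : L → L → L → L → ℂ) (s₁ s₂ s₄ : Fin 2) (c : L) :
    triPairing σ s₁ s₂ s₄ (fun a b d => pairProj σ q (fun c' d' => v a b c' d') c d) =
      ∑ s, ∑ r, weingarten ((q : ℂ) ^ 2) s r * (σ s c * permGram q s₄ s) *
        quadPairing σ s₁ s₂ r r v := by
  have term (Q : L → L → ℂ) (s : Fin 2) (k x : ℂ) :
      ∑ a, ∑ b, ∑ d, σ s₁ a * (σ s₂ b * σ s₄ d * (k * (x * σ s d) * Q a b)) =
        ∑ a, ∑ b, k * (x * permGram q s₄ s) * (σ s₁ a * (σ s₂ b * Q a b)) := by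
    rw [← hσ]
    simp only [Finset.mul_sum, Finset.sum_mul]
    exact Finset.sum_congr rfl fun _ _ => Finset.sum_congr rfl fun _ _ =>
      Finset.sum_congr rfl fun _ _ => by ring
  simp only [pairProj, quadPairing_eq]
  generalize hQ : (fun a b r => pairing σ r r (v a b)) = Q
  have hQ' (a b r) : pairing σ r r (v a b) = Q a b r := by rw [← hQ]
  simp only [hQ']
  simp only [triPairing, pairing, Fin.sum_univ_two, mul_add, Finset.mul_sum,
    Finset.sum_add_distrib, term (fun a b => Q a b _)]

theorem pairing_add (s r : Fin 2) (u w : L → L → ℂ) :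
    pairing σ s r (fun a d => u a d + w a d) = pairing σ s r u + pairing σ s r w := by
  simp [pairing, mul_add, Finset.sum_add_distrib]

theorem pairing_smul (s r : Fin 2) (k : ℂ) (u : L → L → ℂ) :
    pairing σ s r (fun a d => k * u a d) = k * pairing σ s r u := by
  simp only [pairing, Finset.mul_sum]
  exact Finset.sum_congr rfl fun _ _ => Finset.sum_congr rfl fun _ _ => by ring

theorem triPairing_add (s₁ s₂ s₃ : Fin 2) (u w : L → L → L → ℂ) :
    triPairing σ s₁ s₂ s₃ (fun a b d => u a b d + w a b d) =
      triPairing σ s₁ s₂ s₃ u + triPairing σ s₁ s₂ s₃ w := by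
  simp [triPairing, pairing_add, mul_add, Finset.sum_add_distrib]

theorem triPairing_smul (s₁ s₂ s₃ : Fin 2) (k : ℂ) (u : L → L → L → ℂ) :
    triPairing σ s₁ s₂ s₃ (fun a b d => k * u a b d) = k * triPairing σ s₁ s₂ s₃ u := by
  simp only [triPairing, pairing_smul, Finset.mul_sum]
  exact Finset.sum_congr rfl fun _ _ => by ring

theorem quadPairing_add (s₁ s₂ s₃ s₄ : Fin 2) (v w : L → L → L → L → ℂ) :
    quadPairing σ s₁ s₂ s₃ s₄ (fun a b c d => v a b c d + w a b c d) =
      quadPairing σ s₁ s₂ s₃ s₄ v + quadPairing σ s₁ s₂ s₃ s₄ w := by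
  simp [quadPairing, triPairing_add, mul_add, Finset.sum_add_distrib]

theorem quadPairing_smul (s₁ s₂ s₃ s₄ : Fin 2) (k : ℂ) (v : L → L → L → L → ℂ) :
    quadPairing σ s₁ s₂ s₃ s₄ (fun a b c d => k * v a b c d) =
      k * quadPairing σ s₁ s₂ s₃ s₄ v := by
  simp only [quadPairing, triPairing_smul, Finset.mul_sum]
  exact Finset.sum_congr rfl fun _ _ => by ring

theorem overlap_nonneg : 0 ≤ overlap q := by unfold overlap; positivity

theorem overlap_le_one : overlap q ≤ 1 := by
  unfold overlap
  rw [div_le_one (by positivity)]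
  nlinarith [sq_nonneg ((q : ℝ) - 1)]

/-- The eigenvalue equation `t v = (P_{1,4} + P_{2,4} + P_{3,4}) v` on four-site tensors. -/
def IsStarEigen (σ : Fin 2 → L → ℂ) (q : ℕ) (t : ℂ) (v : L → L → L → L → ℂ) : Prop :=
  ∀ a b c d, t * v a b c d = pairProj σ q (fun a' d' => v a' b c d') a d +
    pairProj σ q (fun b' d' => v a b' c d') b d + pairProj σ q (fun c' d' => v a b c' d') c d

namespace IsStarEigen

variable {t : ℝ} {v : L → L → L → L → ℂ}

theorem swap_left {t : ℂ} (h : IsStarEigen σ q t v) :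
    IsStarEigen σ q t fun a b c d => v b a c d := fun a b c d => by
  rw [h b a c d]; ring

theorem swap_right {t : ℂ} (h : IsStarEigen σ q t v) :
    IsStarEigen σ q t fun a b c d => v a c b d := fun a b c d => by
  rw [h a c b d]; ring

theorem quadPairing_eq_zero (hq : 2 ≤ q) (hσ : ∀ s r, ∑ a, σ s a * σ r a = permGram q s r)
    (h : IsStarEigen σ q t v) (ht : 2 < t) (ht3 : t ≠ 3)
    (hμ : 4 * overlap q ^ 2 < (t - 1) * (t - 2)) (s₁ s₂ s₃ s₄ : Fin 2) :
    quadPairing σ s₁ s₂ s₃ s₄ v = 0 := by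
  refine fin_two_four_eq_zero overlap_nonneg ht ht3 hμ
    (fun s₁ s₂ s₃ s₄ => quadPairing σ s₁ s₂ s₃ s₄ v) (fun s₁ s₂ s₃ s₄ => ?_) s₁ s₂ s₃ s₄
  rw [← quadPairing_pairProj_left hq hσ, ← quadPairing_pairProj_middle hq hσ,
    ← quadPairing_pairProj_right hq hσ, ← quadPairing_smul, ← quadPairing_add, ← quadPairing_add]
  exact congrArg _ (funext fun a => funext fun b => funext fun c => funext fun d => h a b c d)

/-- With the third leaf's label fixed, the term acting on that leaf contributes only full pairings,
which vanish; what remains is the star with two leaves. -/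
theorem triPairing_eq_zero (hq : 2 ≤ q) (hσ : ∀ s r, ∑ a, σ s a * σ r a = permGram q s r)
    (h : IsStarEigen σ q t v) (ht : 2 < t)
    (hv : ∀ s₁ s₂ s₃ s₄, quadPairing σ s₁ s₂ s₃ s₄ v = 0) (s₁ s₂ s₄ : Fin 2) (c : L) :
    triPairing σ s₁ s₂ s₄ (fun a b d => v a b c d) = 0 := by
  refine fin_two_three_eq_zero (overlap_nonneg (q := q)) overlap_le_one ht
    (fun s₁ s₂ s₄ => triPairing σ s₁ s₂ s₄ (fun a b d => v a b c d)) (fun s₁ s₂ s₄ => ?_) s₁ s₂ s₄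
  have h3 := triPairing_pairProj_outer hσ v s₁ s₂ s₄ c
  simp only [hv, mul_zero, Finset.sum_const_zero] at h3
  have e0 : triPairing σ s₁ s₂ s₄ (fun a b d => (t : ℂ) * v a b c d) = _ :=
    congrArg _ (funext fun a => funext fun b => funext fun d => h a b c d)
  rw [triPairing_add, triPairing_add, h3, triPairing_smul, add_zero] at e0
  rw [← triPairing_pairProj_left hq hσ, ← triPairing_pairProj_right hq hσ]
  exact e0

/-- Once the triple pairings vanish, the terms on the other two leaves drop out of the diagonal
pairings, leaving `t x = x` with `t ≠ 1`. -/
theorem pairProj_eq_zero (hq : 2 ≤ q) (hσ : ∀ s r, ∑ a, σ s a * σ r a = permGram q s r)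
    (h : IsStarEigen σ q t v) (ht : 2 < t)
    (hv : ∀ s₁ s₂ s₃ s₄, quadPairing σ s₁ s₂ s₃ s₄ v = 0) (a b c d : L) :
    pairProj σ q (fun a' d' => v a' b c d') a d = 0 := by
  have hv' (s₁ s₂ s₃ s₄) : quadPairing σ s₁ s₂ s₃ s₄ (fun a b c d => v a c b d) = 0 := by
    rw [quadPairing_swap_right, hv]
  have h1 (s : Fin 2) : pairing σ s s (fun a d => v a b c d) = 0 := by
    have e1 := pairing_pairProj hq hσ (fun a d => v a b c d) s s
    have e2 := pairing_pairProj_outer hσ (fun a b d => v a b c d) s s b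
    have e3 := pairing_pairProj_outer hσ (fun a c d => v a b c d) s s c
    simp only [h.triPairing_eq_zero hq hσ ht hv, mul_zero, Finset.sum_const_zero] at e2
    simp only [h.swap_right.triPairing_eq_zero hq hσ ht hv', mul_zero, Finset.sum_const_zero] at e3
    rw [if_pos rfl] at e1
    have e : (t : ℂ) * pairing σ s s (fun a d => v a b c d) =
        pairing σ s s (fun a d => v a b c d) + 0 + 0 := by
      have e0 : pairing σ s s (fun a d => (t : ℂ) * v a b c d) = _ :=
        congrArg _ (funext fun a => funext fun d => h a b c d)
      rw [pairing_add, pairing_add, e2, e3, pairing_smul] at e0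
      exact e0.trans (congrArg (· + 0 + 0) e1)
    have ht1 : (t : ℂ) - 1 ≠ 0 := by exact_mod_cast (by linarith : t - 1 ≠ 0)
    exact (mul_eq_zero.mp (by linear_combination e)).resolve_left ht1
  simp [pairProj, h1]

/-- The star operator has no eigenvalue above the second largest one, apart from `3`. -/
theorem eq_zero (hq : 2 ≤ q) (hσ : ∀ s r, ∑ a, σ s a * σ r a = permGram q s r)
    (h : IsStarEigen σ q t v) (ht : 2 < t) (ht3 : t ≠ 3)
    (hμ : 4 * overlap q ^ 2 < (t - 1) * (t - 2)) (a b c d : L) : v a b c d = 0 := by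
  have hv := h.quadPairing_eq_zero hq hσ ht ht3 hμ
  have p1 := h.pairProj_eq_zero hq hσ ht hv a b c d
  have hv2 (s₁ s₂ s₃ s₄) : quadPairing σ s₁ s₂ s₃ s₄ (fun a b c d => v b a c d) = 0 := by
    rw [quadPairing_swap_left, hv]
  have p2 := h.swap_left.pairProj_eq_zero hq hσ ht hv2 b a c d
  have hv3 (s₁ s₂ s₃ s₄) : quadPairing σ s₁ s₂ s₃ s₄ (fun a b c d => v b c a d) = 0 := by
    rw [quadPairing_swap_left s₁ s₂ s₃ s₄ fun a b c d => v a c b d, quadPairing_swap_right, hv]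
  have p3 := h.swap_right.swap_left.pairProj_eq_zero hq hσ ht hv3 c a b d
  have e := h a b c d
  rw [p1, p2, p3] at e
  have ht0 : (t : ℂ) ≠ 0 := by exact_mod_cast (by linarith : t ≠ 0)
  simpa [ht0] using e

end IsStarEigen

end

/-! ### Explicit eigenvectors. -/

noncomputable section

variable {L : Type} [Fintype L] {σ : Fin 2 → L → ℂ} {q : ℕ}

theorem pairProj_combination (hq : 2 ≤ q) (hσ : ∀ s r, ∑ a, σ s a * σ r a = permGram q s r)
    (k₀₀ k₀₁ k₁₀ k₁₁ : ℂ) (a d : L) :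
    pairProj σ q (fun a d => k₀₀ * (σ 0 a * σ 0 d) + k₀₁ * (σ 0 a * σ 1 d) +
      k₁₀ * (σ 1 a * σ 0 d) + k₁₁ * (σ 1 a * σ 1 d)) a d =
      (k₀₀ + overlap q * (k₀₁ + k₁₀)) * (σ 0 a * σ 0 d) +
        (k₁₁ + overlap q * (k₀₁ + k₁₀)) * (σ 1 a * σ 1 d) := by
  have term (s r s' r' : Fin 2) : pairing σ s r (fun a d => σ s' a * σ r' d) =
      permGram q s s' * permGram q r r' := by
    rw [← hσ, ← hσ, Finset.sum_mul_sum, pairing]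
    exact Finset.sum_congr rfl fun _ _ => Finset.sum_congr rfl fun _ _ => by ring
  have hq' : (2 : ℝ) ≤ q := by exact_mod_cast hq
  have h0 : (q : ℂ) ≠ 0 := by
    exact_mod_cast (by linarith : (q : ℝ) ≠ 0)
  have h1 : (q : ℂ) ^ 2 + 1 ≠ 0 := by
    exact_mod_cast (by positivity : (q : ℝ) ^ 2 + 1 ≠ 0)
  have h3 : (q : ℂ) ^ 2 - 1 ≠ 0 := by
    exact_mod_cast (by nlinarith : (q : ℝ) ^ 2 - 1 ≠ 0)
  have h4 : ((q : ℂ) ^ 2) ^ 2 - 1 = ((q : ℂ) ^ 2 - 1) * ((q : ℂ) ^ 2 + 1) := by ring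
  simp only [pairProj, pairing_add, pairing_smul, term, Fin.sum_univ_two,
    weingarten, permGram, overlap, if_true, Fin.isValue, zero_ne_one, one_ne_zero, if_false, h4]
  push_cast
  field_simp
  ring

variable (σ) in
/-- The tensor, symmetric in the leaves and under exchange of `σ 0` and `σ 1`, whose coefficient at
a configuration with `k ≤ 2` leaves different from the centre is `xₖ`. -/
def starVec (x₀ x₁ x₂ : ℂ) (a b c d : L) : ℂ :=
  (x₀ * (σ 0 b * σ 0 c) + x₁ * (σ 1 b * σ 0 c + σ 0 b * σ 1 c) + x₂ * (σ 1 b * σ 1 c)) *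
    (σ 0 a * σ 0 d) +
  (x₁ * (σ 1 b * σ 1 c) + x₂ * (σ 1 b * σ 0 c + σ 0 b * σ 1 c)) * (σ 0 a * σ 1 d) +
  (x₁ * (σ 0 b * σ 0 c) + x₂ * (σ 1 b * σ 0 c + σ 0 b * σ 1 c)) * (σ 1 a * σ 0 d) +
  (x₀ * (σ 1 b * σ 1 c) + x₁ * (σ 1 b * σ 0 c + σ 0 b * σ 1 c) + x₂ * (σ 0 b * σ 0 c)) *
    (σ 1 a * σ 1 d)

/-- The three relations are the action of `T` on the classes `k = 0, 1, 2`. No `k = 3` term is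
needed: the output of each projector has a leaf agreeing with the centre. -/
theorem isStarEigen_starVec (hq : 2 ≤ q) (hσ : ∀ s r, ∑ a, σ s a * σ r a = permGram q s r)
    {t x₀ x₁ x₂ : ℂ} (h₀ : t * x₀ = 3 * x₀ + 3 * overlap q * x₁)
    (h₁ : t * x₁ = 2 * x₁ + 4 * overlap q * x₂) (h₂ : t * x₂ = overlap q * x₁ + x₂) :
    IsStarEigen σ q t (starVec σ x₀ x₁ x₂) := by
  intro a b c d
  -- Leaf symmetry brings the active leaf to the first slot, where `pairProj_combination` applies.
  have hb : (fun b' d' => starVec σ x₀ x₁ x₂ a b' c d') =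
      fun b' d' => starVec σ x₀ x₁ x₂ b' a c d' := by
    funext b' d'; simp only [starVec]; ring
  have hc : (fun c' d' => starVec σ x₀ x₁ x₂ a b c' d') =
      fun c' d' => starVec σ x₀ x₁ x₂ c' a b d' := by
    funext c' d'; simp only [starVec]; ring
  rw [hb, hc]
  simp only [starVec, pairProj_combination hq hσ]
  linear_combination
    (σ 0 a * σ 0 b * σ 0 c * σ 0 d + σ 1 a * σ 1 b * σ 1 c * σ 1 d) * h₀ +
    ((σ 1 a * σ 0 b * σ 0 c + σ 0 a * σ 1 b * σ 0 c + σ 0 a * σ 0 b * σ 1 c) * σ 0 d +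
      (σ 0 a * σ 1 b * σ 1 c + σ 1 a * σ 0 b * σ 1 c + σ 1 a * σ 1 b * σ 0 c) * σ 1 d) * h₁ +
    ((σ 1 a * σ 0 b * σ 0 c + σ 0 a * σ 1 b * σ 0 c + σ 0 a * σ 0 b * σ 1 c) * σ 1 d +
      (σ 0 a * σ 1 b * σ 1 c + σ 1 a * σ 0 b * σ 1 c + σ 1 a * σ 1 b * σ 0 c) * σ 0 d) * h₂

end

/-! ### From matrices on basis labels to tensors on sites. -/

noncomputable section

open MeasureTheory

variable {n q : ℕ}

/-- Basis of the two copies and two conjugate copies of a single qudit. -/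
abbrev Site (q : ℕ) : Type := (Fin 2 → Fin q) × (Fin 2 → Fin q)

/-- The components of a basis label at the site `v`. -/
def site (x : Idx n q 2) (v : Fin n) : Site q := (fun a => x.1 a v, fun a => x.2 a v)

theorem localMoment_two_apply (hq : 2 ≤ q) (i j : Fin n) (x y : Idx n q 2) :
    localMoment q 2 i j x y =
      if ∀ v, v ≠ i → v ≠ j → site x v = site y v then
        ∑ s, ∑ r, weingarten ((q : ℂ) ^ 2) s r * (permVec s (site x i) * permVec s (site x j)) *
          (permVec r (site y i) * permVec r (site y j))
      else 0 := by
  have : Nontrivial (Fin q × Fin q) := by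
    have : Nontrivial (Fin q) := Fin.nontrivial_iff_two_le.mpr hq
    have : Nonempty (Fin q) := inferInstance
    infer_instance
  set p : Idx n q 2 → (Fin 2 → Fin q × Fin q) × (Fin 2 → Fin q × Fin q) :=
    fun x => (fun a => (x.1 a i, x.1 a j), fun a => (x.2 a i, x.2 a j)) with hp
  have hperm (s : Fin 2) (x : Idx n q 2) :
      permVec s (p x) = permVec s (site x i) * permVec s (site x j) := by
    rw [permVec, permVec, permVec, ite_zero_mul_ite_zero, mul_one]
    refine if_congr ?_ rfl rfl
    simp only [hp, site, Prod.mk.injEq]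
    tauto
  split_ifs with h
  · have h1 : localMoment q 2 i j x y = haarMoment (Fin q × Fin q) 2 (p x) (p y) := by
      simp only [localMoment, haarMoment, Matrix.of_apply]
      refine integral_congr_ae (Filter.Eventually.of_forall fun U => ?_)
      have hl (a : Fin 2) : ∀ v, v ≠ i → v ≠ j → x.1 a v = y.1 a v := fun v hi hj =>
        congrFun (congrArg Prod.fst (h v hi hj)) a
      have hr (a : Fin 2) : ∀ v, v ≠ i → v ≠ j → x.2 a v = y.2 a v := fun v hi hj =>
        congrFun (congrArg Prod.snd (h v hi hj)) a
      simp only [tensorPowConj, tensorPow, Matrix.kroneckerMap_apply, Matrix.of_apply,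
        Matrix.map_apply, twoSite, if_pos (hl _), if_pos (hr _), hp]
    rw [h1, haarMoment_two_apply]
    simp only [hperm, Fintype.card_prod, Fintype.card_fin, ← sq, Nat.cast_pow, mul_assoc]
  · have h1 (U : Matrix (Fin q × Fin q) (Fin q × Fin q) ℂ) :
        tensorPowConj 2 (twoSite i j U) x y = 0 := by
      by_contra h0
      simp only [tensorPowConj, tensorPow, Matrix.kroneckerMap_apply, Matrix.of_apply,
        Matrix.map_apply, twoSite, mul_eq_zero, not_or, Finset.prod_ne_zero_iff, map_ne_zero,
        Finset.mem_univ, true_imp_iff] at h0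
      refine h fun v hi hj => Prod.ext (funext fun a => ?_) (funext fun a => ?_)
      · by_contra hne
        exact h0.1 a (if_neg fun hh => hne (hh v hi hj))
      · by_contra hne
        exact h0.2 a (if_neg fun hh => hne (hh v hi hj))
    simp [localMoment, h1]

theorem localMoment_isHermitian (hq : 2 ≤ q) (i j : Fin n) :
    (localMoment q 2 i j).IsHermitian := by
  ext x y
  rw [Matrix.conjTranspose_apply, localMoment_two_apply hq, localMoment_two_apply hq]
  simp only [eq_comm (b := site x _)]
  rw [apply_ite star, star_zero]
  congr 1
  have hp {Y : Type} [DecidableEq Y] (s : Fin 2) (x : (Fin 2 → Y) × (Fin 2 → Y)) :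
      star (permVec s x) = permVec s x := by
    unfold permVec; split_ifs <;> simp
  have hw (s r : Fin 2) : star (weingarten ((q : ℂ) ^ 2) s r) = weingarten ((q : ℂ) ^ 2) s r := by
    unfold weingarten; split_ifs <;> simp
  simp only [star_sum, star_mul', hp, hw]
  rw [Finset.sum_comm]
  refine Finset.sum_congr rfl fun s _ => Finset.sum_congr rfl fun r _ => ?_
  have : weingarten ((q : ℂ) ^ 2) r s = weingarten ((q : ℂ) ^ 2) s r := by
    simp only [weingarten, eq_comm]
  rw [this]; ring

/-- A basis label of four sites is a quadruple of single-site labels. -/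
def siteEquiv (q : ℕ) : Idx 4 q 2 ≃ Site q × Site q × Site q × Site q where
  toFun x := (site x 0, site x 1, site x 2, site x 3)
  invFun z := (fun a => ![z.1.1 a, z.2.1.1 a, z.2.2.1.1 a, z.2.2.2.1 a],
    fun a => ![z.1.2 a, z.2.1.2 a, z.2.2.1.2 a, z.2.2.2.2 a])
  left_inv x := by
    refine Prod.ext (funext fun a => funext fun v => ?_) (funext fun a => funext fun v => ?_) <;>
    fin_cases v <;> rfl
  right_inv z := rfl

/-- A vector on four sites as a function of the four single-site labels. -/
def toTensor (V : Idx 4 q 2 → ℂ) (a b c d : Site q) : ℂ := V ((siteEquiv q).symm (a, b, c, d))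

theorem sum_idx (g : Idx 4 q 2 → ℂ) :
    ∑ x, g x = ∑ a, ∑ b, ∑ c, ∑ d, g ((siteEquiv q).symm (a, b, c, d)) := by
  rw [← (siteEquiv q).symm.sum_comp]
  simp only [Fintype.sum_prod_type]

theorem site_siteEquiv_symm (a b c d : Site q) :
    site ((siteEquiv q).symm (a, b, c, d)) 0 = a ∧ site ((siteEquiv q).symm (a, b, c, d)) 1 = b ∧
    site ((siteEquiv q).symm (a, b, c, d)) 2 = c ∧ site ((siteEquiv q).symm (a, b, c, d)) 3 = d :=
  ⟨rfl, rfl, rfl, rfl⟩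

theorem sum_sum_eq_pairProj (u : Site q → Site q → ℂ) (a d : Site q) :
    ∑ a', ∑ d', (∑ s, ∑ r, weingarten ((q : ℂ) ^ 2) s r * (permVec s a * permVec s d) *
      (permVec r a' * permVec r d')) * u a' d' = pairProj permVec q u a d := by
  simp only [pairProj, pairing, Finset.mul_sum, Finset.sum_mul]
  simp_rw [Finset.sum_comm (s := Finset.univ (α := Site q)) (t := Finset.univ (α := Fin 2))]
  simp only [mul_assoc]

theorem toTensor_localMoment_zero (hq : 2 ≤ q) (V : Idx 4 q 2 → ℂ) (a b c d : Site q) :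
    toTensor (Matrix.mulVec (localMoment q 2 0 3) V) a b c d =
      pairProj permVec q (fun a' d' => toTensor V a' b c d') a d := by
  rw [toTensor, Matrix.mulVec, dotProduct, sum_idx, ← sum_sum_eq_pairProj]
  have h (a' b' c' d' : Site q) : (∀ v : Fin 4, v ≠ 0 → v ≠ 3 →
      site ((siteEquiv q).symm (a, b, c, d)) v = site ((siteEquiv q).symm (a', b', c', d')) v) ↔
      b = b' ∧ c = c' := by
    simp [Fin.forall_fin_succ, site_siteEquiv_symm]
  simp only [localMoment_two_apply hq, h, site_siteEquiv_symm, ite_mul, zero_mul, ite_and]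
  simp [toTensor]

theorem toTensor_localMoment_one (hq : 2 ≤ q) (V : Idx 4 q 2 → ℂ) (a b c d : Site q) :
    toTensor (Matrix.mulVec (localMoment q 2 1 3) V) a b c d =
      pairProj permVec q (fun b' d' => toTensor V a b' c d') b d := by
  rw [toTensor, Matrix.mulVec, dotProduct, sum_idx, ← sum_sum_eq_pairProj]
  have h (a' b' c' d' : Site q) : (∀ v : Fin 4, v ≠ 1 → v ≠ 3 →
      site ((siteEquiv q).symm (a, b, c, d)) v = site ((siteEquiv q).symm (a', b', c', d')) v) ↔
      a = a' ∧ c = c' := by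
    simp [Fin.forall_fin_succ, site_siteEquiv_symm]
  simp only [localMoment_two_apply hq, h, site_siteEquiv_symm, ite_mul, zero_mul, ite_and]
  simp [toTensor]

theorem toTensor_localMoment_two (hq : 2 ≤ q) (V : Idx 4 q 2 → ℂ) (a b c d : Site q) :
    toTensor (Matrix.mulVec (localMoment q 2 2 3) V) a b c d =
      pairProj permVec q (fun c' d' => toTensor V a b c' d') c d := by
  rw [toTensor, Matrix.mulVec, dotProduct, sum_idx, ← sum_sum_eq_pairProj]
  have h (a' b' c' d' : Site q) : (∀ v : Fin 4, v ≠ 2 → v ≠ 3 →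
      site ((siteEquiv q).symm (a, b, c, d)) v = site ((siteEquiv q).symm (a', b', c', d')) v) ↔
      a = a' ∧ b = b' := by
    simp [Fin.forall_fin_succ, site_siteEquiv_symm]
  simp only [localMoment_two_apply hq, h, site_siteEquiv_symm, ite_mul, zero_mul, ite_and]
  simp [toTensor]

end

/-! ### The spectrum of the star Hamiltonian and its gap. -/

noncomputable section

variable {q : ℕ}

theorem starHamiltonian_three (q k : ℕ) :
    starHamiltonian 3 q k = localTerm q k 0 3 + localTerm q k 1 3 + localTerm q k 2 3 := by
  have h : (Finset.univ.filter fun e : Fin 4 × Fin 4 =>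
      e.1 < e.2 ∧ (SimpleGraph.starGraph (Fin.last 3)).Adj e.1 e.2) = {(0, 3), (1, 3), (2, 3)} := by
    decide
  unfold starHamiltonian hamiltonian
  rw [h, Finset.sum_insert (by decide), Finset.sum_insert (by decide), Finset.sum_singleton,
    add_assoc]

theorem starHamiltonian_isHermitian (hq : 2 ≤ q) : (starHamiltonian 3 q 2).IsHermitian := by
  have h (i j : Fin 4) : (localTerm q 2 i j).IsHermitian :=
    Matrix.isHermitian_one.sub (localMoment_isHermitian hq i j)
  rw [starHamiltonian_three]
  exact ((h 0 3).add (h 1 3)).add (h 2 3)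

theorem mem_spectrum_real_iff {X : Type} [Fintype X] [DecidableEq X] (A : Matrix X X ℂ) (μ : ℝ) :
    μ ∈ spectrum ℝ A ↔ ∃ V : X → ℂ, V ≠ 0 ∧ A.mulVec V = (μ : ℂ) • V := by
  rw [spectrum.mem_iff, Matrix.isUnit_iff_isUnit_det, isUnit_iff_ne_zero, not_not,
    ← Matrix.exists_mulVec_eq_zero_iff]
  refine exists_congr fun V => and_congr_right fun _ => ?_
  rw [Matrix.sub_mulVec, sub_eq_zero, eq_comm, Algebra.algebraMap_eq_smul_one,
    Matrix.smul_mulVec, Matrix.one_mulVec]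
  rfl

theorem sum_permVec_site (s r : Fin 2) :
    ∑ a : Site q, permVec s a * permVec r a = permGram q s r := by
  rw [sum_permVec_mul, Fintype.card_fin, permGram]

theorem starHamiltonian_mulVec_iff (hq : 2 ≤ q) (V : Idx 4 q 2 → ℂ) (μ : ℝ) :
    (starHamiltonian 3 q 2).mulVec V = (μ : ℂ) • V ↔
      IsStarEigen permVec q ((3 - μ : ℝ) : ℂ) (toTensor V) := by
  have key (a b c d : Site q) : toTensor ((starHamiltonian 3 q 2).mulVec V) a b c d =
      3 * toTensor V a b c d - (pairProj permVec q (fun a' d' => toTensor V a' b c d') a d +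
        pairProj permVec q (fun b' d' => toTensor V a b' c d') b d +
        pairProj permVec q (fun c' d' => toTensor V a b c' d') c d) := by
    rw [← toTensor_localMoment_zero hq, ← toTensor_localMoment_one hq,
      ← toTensor_localMoment_two hq, starHamiltonian_three]
    simp only [localTerm, Matrix.add_mulVec, Matrix.sub_mulVec, Matrix.one_mulVec, toTensor,
      Pi.add_apply, Pi.sub_apply]
    ring
  constructor
  · intro h a b c d
    have e := key a b c d
    rw [h] at e
    simp only [toTensor, Pi.smul_apply, smul_eq_mul] at e ⊢
    push_cast
    linear_combination -e
  · intro h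
    funext x
    obtain ⟨⟨a, b, c, d⟩, rfl⟩ := (siteEquiv q).symm.surjective x
    have e := key a b c d
    rw [← h a b c d] at e
    simp only [toTensor, Pi.smul_apply, smul_eq_mul] at e ⊢
    rw [e]
    push_cast
    ring

theorem mem_spectrum_starHamiltonian_iff (hq : 2 ≤ q) (μ : ℝ) :
    μ ∈ spectrum ℝ (starHamiltonian 3 q 2) ↔
      ∃ v : Site q → Site q → Site q → Site q → ℂ, (∃ a b c d, v a b c d ≠ 0) ∧
        IsStarEigen permVec q ((3 - μ : ℝ) : ℂ) v := by
  rw [mem_spectrum_real_iff]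
  constructor
  · rintro ⟨V, hV, h⟩
    refine ⟨toTensor V, ?_, (starHamiltonian_mulVec_iff hq V μ).mp h⟩
    obtain ⟨x, hx⟩ := Function.ne_iff.mp hV
    obtain ⟨⟨a, b, c, d⟩, rfl⟩ := (siteEquiv q).symm.surjective x
    exact ⟨a, b, c, d, hx⟩
  · rintro ⟨v, ⟨a, b, c, d, hv⟩, h⟩
    have ht : toTensor (fun x => v (siteEquiv q x).1 (siteEquiv q x).2.1 (siteEquiv q x).2.2.1
        (siteEquiv q x).2.2.2) = v := by
      funext a b c d
      simp [toTensor]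
    refine ⟨_, fun h0 => hv ?_, (starHamiltonian_mulVec_iff hq _ μ).mpr (ht.symm ▸ h)⟩
    rw [← ht, h0]
    rfl

/-- The second smallest eigenvalue of the star Hamiltonian with three leaves. -/
def starGap (q : ℕ) : ℝ :=
  3 / 2 - √((q : ℝ) ^ 4 + 18 * (q : ℝ) ^ 2 + 1) / (2 * ((q : ℝ) ^ 2 + 1))

theorem starGap_quadratic (q : ℕ) :
    starGap q ^ 2 - 3 * starGap q + 2 - 4 * overlap q ^ 2 = 0 := by
  have hs : √((q : ℝ) ^ 4 + 18 * (q : ℝ) ^ 2 + 1) ^ 2 = (q : ℝ) ^ 4 + 18 * (q : ℝ) ^ 2 + 1 :=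
    Real.sq_sqrt (by positivity)
  have h1 : (q : ℝ) ^ 2 + 1 ≠ 0 := by positivity
  unfold starGap overlap
  generalize √((q : ℝ) ^ 4 + 18 * (q : ℝ) ^ 2 + 1) = s at hs
  field_simp
  linear_combination hs

theorem starGap_bounds (hq : 2 ≤ q) : 0 < starGap q ∧ starGap q < 1 := by
  have hq' : (2 : ℝ) ≤ q := by exact_mod_cast hq
  have hpos : 0 < 2 * ((q : ℝ) ^ 2 + 1) := by positivity
  have h1 : (q : ℝ) ^ 2 + 1 < √((q : ℝ) ^ 4 + 18 * (q : ℝ) ^ 2 + 1) :=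
    Real.lt_sqrt_of_sq_lt (by nlinarith)
  have h2 : √((q : ℝ) ^ 4 + 18 * (q : ℝ) ^ 2 + 1) < 3 * ((q : ℝ) ^ 2 + 1) :=
    (Real.sqrt_lt' (by positivity)).mpr (by nlinarith [pow_pos (by linarith : (0 : ℝ) < q) 4])
  unfold starGap
  constructor
  · rw [sub_pos, div_lt_iff₀ hpos]; linarith
  · rw [sub_lt_iff_lt_add, ← sub_lt_iff_lt_add', lt_div_iff₀ hpos]; linarith

/-- A basis label at which only `permVec s` is nonzero. -/
theorem exists_site_permVec (hq : 2 ≤ q) (s : Fin 2) :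
    ∃ a : Site q, ∀ r, permVec r a = if r = s then 1 else 0 := by
  let z : Fin q := ⟨0, by omega⟩
  let o : Fin q := ⟨1, by omega⟩
  have hzo : z ≠ o := by simp [z, o]
  match s with
  | 0 => exact ⟨(![z, o], ![z, o]), fun r => by fin_cases r <;> simp [permVec, hzo]⟩
  | 1 => exact ⟨(![z, o], ![o, z]), fun r => by fin_cases r <;> simp [permVec, hzo]⟩

theorem zero_mem_spectrum (hq : 2 ≤ q) : (0 : ℝ) ∈ spectrum ℝ (starHamiltonian 3 q 2) := by
  rw [mem_spectrum_starHamiltonian_iff hq]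
  obtain ⟨a, ha⟩ := exists_site_permVec hq 0
  refine ⟨starVec permVec 1 0 0, ⟨a, a, a, a, ?_⟩,
    isStarEigen_starVec hq sum_permVec_site (by simp) (by simp) (by simp)⟩
  simp [starVec, ha]

theorem starGap_mem_spectrum (hq : 2 ≤ q) : starGap q ∈ spectrum ℝ (starHamiltonian 3 q 2) := by
  rw [mem_spectrum_starHamiltonian_iff hq]
  obtain ⟨a, ha⟩ := exists_site_permVec hq 0
  obtain ⟨b, hb⟩ := exists_site_permVec hq 1
  obtain ⟨hg0, hg1⟩ := starGap_bounds hq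
  have hquad : (starGap q : ℂ) ^ 2 - 3 * starGap q + 2 - 4 * overlap q ^ 2 = 0 := by
    exact_mod_cast starGap_quadratic q
  -- Solves the three relations at `t = 3 - starGap q` with denominators cleared; the middle one is
  -- `starGap_quadratic`. At `(b, a, a, a)` only the `k = 1` coefficient survives.
  refine ⟨starVec permVec (-3 * overlap q * (2 - starGap q)) ((2 - starGap q) * starGap q)
    (overlap q * starGap q), ⟨b, a, a, a, ?_⟩,
    isStarEigen_starVec hq sum_permVec_site ?_ ?_ ?_⟩
  · have h : ((2 - starGap q) * starGap q : ℝ) ≠ 0 := by nlinarith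
    have h' : ((2 : ℂ) - starGap q) * starGap q ≠ 0 := by exact_mod_cast h
    simpa [starVec, ha, hb] using h'
  · push_cast; ring
  · push_cast; linear_combination (starGap q : ℂ) * hquad
  · push_cast; ring

theorem isSpectralGap_starHamiltonian (hq : 2 ≤ q) :
    IsSpectralGap (starHamiltonian 3 q 2) (starGap q) := by
  obtain ⟨hg0, hg1⟩ := starGap_bounds hq
  have key (μ : ℝ) (hμ : μ ∈ spectrum ℝ (starHamiltonian 3 q 2)) (h0 : μ ≠ 0) :
      starGap q ≤ μ := by
    by_contra! hlt
    obtain ⟨v, ⟨a, b, c, d, hv⟩, h⟩ := (mem_spectrum_starHamiltonian_iff hq μ).mp hμ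
    refine hv (h.eq_zero hq sum_permVec_site (by linarith) (fun h3 => h0 (by linarith)) ?_ a b c d)
    -- `(2 - μ)(1 - μ)` is strictly decreasing below 1 and equals `4 α²` at `starGap q`. Negative
    -- `μ` are excluded too, so positivity of the Hamiltonian need not be shown separately.
    nlinarith [starGap_quadratic q]
  refine ⟨starHamiltonian_isHermitian hq, 0, ⟨zero_mem_spectrum hq, fun μ hμ => ?_⟩, ?_, ?_⟩
  · by_cases h0 : μ = 0
    · exact h0.ge
    · exact hg0.le.trans (key μ hμ h0)
  · rw [zero_add]
    exact ⟨starGap_mem_spectrum hq, hg0.ne'⟩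
  · rintro μ ⟨hμ, h0⟩
    rw [zero_add]
    exact key μ hμ h0

theorem IsSpectralGap.unique {X : Type} [Fintype X] [DecidableEq X] {H : Matrix X X ℂ} {Δ Δ' : ℝ}
    (h : IsSpectralGap H Δ) (h' : IsSpectralGap H Δ') : Δ = Δ' := by
  obtain ⟨-, E, hE, hΔ⟩ := h
  obtain ⟨-, E', hE', hΔ'⟩ := h'
  obtain rfl := hE.unique hE'
  exact add_left_cancel (hΔ.unique hΔ')

theorem tendsto_starGap : Filter.Tendsto starGap Filter.atTop (nhds 1) := by
  have hlim : Filter.Tendsto (fun q : ℕ => 1 - 4 / ((q : ℝ) ^ 2 + 1)) Filter.atTop (nhds 1) := by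
    have h : Filter.Tendsto (fun q : ℕ => (q : ℝ) ^ 2 + 1) Filter.atTop Filter.atTop :=
      Filter.tendsto_atTop_add_const_right _ _
        ((Filter.tendsto_pow_atTop two_ne_zero).comp tendsto_natCast_atTop_atTop)
    simpa using (h.const_div_atTop 4).const_sub 1
  refine tendsto_of_tendsto_of_tendsto_of_le_of_le' hlim tendsto_const_nhds
    (Filter.Eventually.of_forall fun q => ?_) (Filter.eventually_atTop.mpr
      ⟨2, fun q hq => (starGap_bounds hq).2.le⟩)
  have h1 : (0 : ℝ) < (q : ℝ) ^ 2 + 1 := by positivity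
  -- Completing the square: `(q² + 9)²` exceeds the radicand by 80.
  have h2 : √((q : ℝ) ^ 4 + 18 * (q : ℝ) ^ 2 + 1) ≤ (q : ℝ) ^ 2 + 9 :=
    Real.sqrt_le_iff.mpr ⟨by positivity, by nlinarith⟩
  have h3 : √((q : ℝ) ^ 4 + 18 * (q : ℝ) ^ 2 + 1) / (2 * ((q : ℝ) ^ 2 + 1)) ≤
      ((q : ℝ) ^ 2 + 9) / (2 * ((q : ℝ) ^ 2 + 1)) := by gcongr
  have h4 : ((q : ℝ) ^ 2 + 9) / (2 * ((q : ℝ) ^ 2 + 1)) = 1 / 2 + 4 / ((q : ℝ) ^ 2 + 1) := by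
    field_simp; ring
  unfold starGap
  linarith

theorem starGap_two : starGap 2 = 3 / 2 - √89 / 10 := by
  have h : √((2 : ℝ) ^ 4 + 18 * 2 ^ 2 + 1) = √89 := by norm_num
  unfold starGap
  push_cast
  rw [h]
  norm_num

end

end RQC

theorem mainTheorem12 :
    (∀ q : ℕ, 2 ≤ q →
      RQC.starHamiltonian 3 q 2 =
          RQC.localTerm q 2 0 3 + RQC.localTerm q 2 1 3 + RQC.localTerm q 2 2 3 ∧
        RQC.IsSpectralGap (RQC.starHamiltonian 3 q 2)
          (3 / 2 - √((q : ℝ) ^ 4 + 18 * (q : ℝ) ^ 2 + 1) / (2 * ((q : ℝ) ^ 2 + 1)))) ∧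
    RQC.IsSpectralGap (RQC.starHamiltonian 3 2 2) (3 / 2 - √89 / 10) ∧
    |(3 / 2 - √89 / 10 : ℝ) - 0.556602| < 0.0000005 ∧
    ∀ Δ : ℕ → ℝ, (∀ q : ℕ, 2 ≤ q → RQC.IsSpectralGap (RQC.starHamiltonian 3 q 2) (Δ q)) →
      Filter.Tendsto Δ Filter.atTop (nhds 1) := by
  refine ⟨fun q hq => ⟨RQC.starHamiltonian_three q 2, RQC.isSpectralGap_starHamiltonian hq⟩,
    RQC.starGap_two ▸ RQC.isSpectralGap_starHamiltonian le_rfl, ?_, fun Δ hΔ => ?_⟩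
  · have h1 : (9.433978 : ℝ) < √89 := Real.lt_sqrt_of_sq_lt (by norm_num)
    have h2 : √89 < (9.433984 : ℝ) := (Real.sqrt_lt' (by norm_num)).mpr (by norm_num)
    rw [abs_lt]
    constructor <;> linarith
  · refine RQC.tendsto_starGap.congr' (Filter.eventually_atTop.mpr ⟨2, fun q hq => ?_⟩)
    exact (RQC.isSpectralGap_starHamiltonian hq).unique (hΔ q hq)
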